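/- Let $n$ be a nonnegative integer, $\Omega=\mathbb R^n\times(0,+\infty)\subset\mathbb R^{n+1}$, and identify $\partial\Omega=\mathbb R^n\times\{0\}$, with the Hausdorff measure $\mathcal H^n$, with $\mathbb R^n$ and its Lebesgue measure. Let $BV(\Omega)$ be the set of $u\in L^1(\Omega)$ whose total variation $$\int_\Omega|Du|=\sup\Big\{\int_\Omega u\,\operatorname{div}\varphi\,dx:\ \varphi\in C^1_c(\Omega;\mathbb R^{n+1}),\ |\varphi|\le1\Big\}$$ is finite, let $BV(\Omega,\{0,1\})$ be the set of $E\subseteq\Omega$ with $\chi_E\in BV(\Omega)$, and put $P(E,\Omega)=\int_\Omega|D\chi_E|$. The trace of $u\in BV(\Omega)$ on $\partial\Omega$, again denoted by $u$, is defined for $\mathcal H^n$-a.e. $x\in\partial\Omega$ by $$\lim_{r\to0^+}\frac1{|B_r(x)\cap\Omega|}\int_{B_r(x)\cap\Omega}|u(y)-u(x)|\,dy=0 .$$ Let $\beta\in L^\infty(\partial\Omega)$, and define the capillary functional and its level-set version by $$\mathcal C_\beta(E,\Omega)=P(E,\Omega)-\int_{\partial\Omega}\beta\,\chi_E\,d\mathcal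 H^n\quad(E\in BV(\Omega,\{0,1\})),$$ $$\mathtt C_\beta(u,\Omega)=\int_\Omega|Du|-\int_{\partial\Omega}\beta\,u\,d\mathcal H^n\quad(u\in BV(\Omega)).$$ Then $\mathcal C_\beta(\cdot,\Omega)$ is lower semicontinuous on $BV(\Omega,\{0,1\})$ with respect to the $L^1(\Omega)$ topology ($E_k\to E$ meaning $|E_k\Delta E|\to0$) if and only if $\|\beta\|_{L^\infty(\partial\Omega)}\le1$. Likewise $\mathtt C_\beta(\cdot,\Omega)$ is lower semicontinuous on $BV(\Omega)$ with respect to the $L^1(\Omega)$ topology if and only if $\|\beta\|_{L^\infty(\partial\Omega)}\le1$. -/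

import Mathlib

open MeasureTheory Filter
open scoped Topology ENNReal

namespace Capillary

noncomputable section

/-- The open half-space `ℝⁿ × (0, ∞)` in `ℝⁿ⁺¹`. -/
def halfSpace (n : ℕ) : Set (EuclideanSpace ℝ (Fin (n + 1))) :=
  {x | 0 < x (Fin.last n)}

/-- The identification of `ℝⁿ` with the boundary `ℝⁿ × {0}` of the half-space. The `n`-dimensional
Hausdorff measure (normalised as usual) on the boundary is Lebesgue measure on `ℝⁿ`. -/
def boundaryPoint {n : ℕ} (x : EuclideanSpace ℝ (Fin n)) : EuclideanSpace ℝ (Fin (n + 1)) :=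
  WithLp.toLp 2 (Fin.snoc (α := fun _ => ℝ) (fun i => x i) 0)

/-- The divergence of a vector field on `ℝᵈ`. -/
def divergence {d : ℕ} (φ : EuclideanSpace ℝ (Fin d) → EuclideanSpace ℝ (Fin d))
    (x : EuclideanSpace ℝ (Fin d)) : ℝ :=
  ∑ i, fderiv ℝ φ x (EuclideanSpace.single i 1) i

/-- Admissible test fields for the total variation in `U`: `C¹` vector fields, compactly
supported in `U`, of Euclidean norm at most one everywhere. -/
structure IsTestField {d : ℕ} (U : Set (EuclideanSpace ℝ (Fin d)))
    (φ : EuclideanSpace ℝ (Fin d) → EuclideanSpace ℝ (Fin d)) : Prop where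
  contDiff : ContDiff ℝ 1 φ
  hasCompactSupport : HasCompactSupport φ
  tsupport_subset : tsupport φ ⊆ U
  norm_le_one : ∀ x, ‖φ x‖ ≤ 1

/-- The total variation `∫_U |Du|`, as the supremum of `∫_U u div φ` over the test fields. -/
def totalVariation {d : ℕ} (U : Set (EuclideanSpace ℝ (Fin d)))
    (u : EuclideanSpace ℝ (Fin d) → ℝ) : ℝ≥0∞ :=
  ⨆ (φ : EuclideanSpace ℝ (Fin d) → EuclideanSpace ℝ (Fin d)) (_ : IsTestField U φ),
    ENNReal.ofReal (∫ x in U, u x * divergence φ x)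

/-- `u ∈ BV(U)`: `u ∈ L¹(U)` and `u` has finite total variation in `U`. -/
structure IsBV {d : ℕ} (U : Set (EuclideanSpace ℝ (Fin d)))
    (u : EuclideanSpace ℝ (Fin d) → ℝ) : Prop where
  integrableOn : IntegrableOn u U
  totalVariation_lt_top : totalVariation U u < ∞

/-- The space `BV(Ω)`, `Ω` the half-space. Only the values in `Ω`, up to null sets, matter. -/
structure BV (n : ℕ) where
  toFun : EuclideanSpace ℝ (Fin (n + 1)) → ℝ
  isBV : IsBV (halfSpace n) toFun

/-- The class in `L¹(Ω)` of a function in `BV(Ω)`. -/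
def BV.toL1 {n : ℕ} (u : BV n) : Lp ℝ 1 (volume.restrict (halfSpace n)) :=
  Integrable.toL1 u.toFun u.isBV.integrableOn

/-- `BV(Ω)` carries the topology of `L¹(Ω)`, not that of the `BV` norm. -/
instance (n : ℕ) : TopologicalSpace (BV n) :=
  TopologicalSpace.induced BV.toL1 inferInstance

/-- The space `BV(Ω, {0,1})` of subsets of the half-space `Ω` whose characteristic function is
in `BV(Ω)`. -/
structure BVSet (n : ℕ) where
  carrier : Set (EuclideanSpace ℝ (Fin (n + 1)))
  subset : carrier ⊆ halfSpace n
  isBV : IsBV (halfSpace n) (carrier.indicator fun _ => 1)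

/-- The characteristic function of a set in `BV(Ω, {0,1})`. -/
def BVSet.char {n : ℕ} (E : BVSet n) : BV n :=
  ⟨E.carrier.indicator fun _ => 1, E.isBV⟩

/-- `BV(Ω, {0,1})` carries the `L¹(Ω)` topology: `E_k → E` iff `|E_k Δ E| → 0`. -/
instance (n : ℕ) : TopologicalSpace (BVSet n) :=
  TopologicalSpace.induced BVSet.char inferInstance

/-- `a` is the (interior) trace value of `u` at the boundary point `x`:
the mean of `|u - a|` over `B_r(x) ∩ Ω` tends to `0` as `r → 0+`. -/
def HasTraceAt {n : ℕ} (u : EuclideanSpace ℝ (Fin (n + 1)) → ℝ)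
    (x : EuclideanSpace ℝ (Fin n)) (a : ℝ) : Prop :=
  Tendsto (fun r : ℝ => ⨍ y in Metric.ball (boundaryPoint x) r ∩ halfSpace n, |u y - a|)
    (𝓝[>] 0) (𝓝 0)

open Classical in
/-- The trace of `u` on `∂Ω`, set to `0` at the points without a trace value
(for `u` in `BV(Ω)` these form a null set). -/
def trace {n : ℕ} (u : EuclideanSpace ℝ (Fin (n + 1)) → ℝ)
    (x : EuclideanSpace ℝ (Fin n)) : ℝ :=
  if h : ∃ a, HasTraceAt u x a then h.choose else 0

/-- The perimeter `P(E, U)`. -/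
def perimeter {d : ℕ} (E U : Set (EuclideanSpace ℝ (Fin d))) : ℝ≥0∞ :=
  totalVariation U (E.indicator fun _ => 1)

/-- The capillary functional `P(E, Ω) - ∫_{∂Ω} β χ_E` on `BV(Ω, {0,1})`, where `χ_E` on `∂Ω`
is the trace of the characteristic function of `E`. -/
def capillary {n : ℕ} (β : EuclideanSpace ℝ (Fin n) → ℝ) (E : BVSet n) : ℝ :=
  (perimeter E.carrier (halfSpace n)).toReal - ∫ x, β x * trace E.char.toFun x

/-- The level-set capillary functional `∫_Ω |Du| - ∫_{∂Ω} β u` on `BV(Ω)`. -/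
def levelSetCapillary {n : ℕ} (β : EuclideanSpace ℝ (Fin n) → ℝ) (u : BV n) : ℝ :=
  (totalVariation (halfSpace n) u.toFun).toReal - ∫ x, β x * trace u.toFun x

end

end Capillary

/-!
Both functionals are compared through averages over thin layers at the boundary.

For `u ∈ BV(Ω)` let `A_ε u` be a smoothly weighted average of `u` over heights `0 < t < ε`. Testing
the total variation with vertical fields `ψ e_{n+1}` shows that averages over sublayers of
`0 < t < ε` differ in `L¹(ℝⁿ)` by at most `|Du|(0 < t < ε)`
(`integral_abs_layerAverage_sub_le`), and this tends to `0` because the total variation is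
superadditive on disjoint sets. So `A_ε u` converges in `L¹(ℝⁿ)` to some `τ` with
`‖τ - A_ε u‖ ≤ |Du|(0 < t < ε)`. A similar test field gives
`∫_{U × (0, r)} |u - τ| ≤ r |Du|(U × (0, r))` (`integral_abs_sub_boundary_value_le`). By a Vitali
covering argument, `|Du|(B_r(x) × (0, r)) = o(rⁿ)` for almost every `x`, hence `τ` is the trace of
`u` at almost every Lebesgue point of `τ` (`ae_hasTraceAt`).

If `|β| ≤ 1`, then for a test field `φ` supported above height `ε` the functional
`u ↦ ∫ u div φ - ∫ β A_ε u` is `L¹`-continuous, and it is at most `∫ |Du| - ∫ β u`, since replacing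
the trace by `A_ε u` costs no more than the total variation in the layer below the support of `φ`.
The capillary functional is the supremum of these functionals, so it is lower semicontinuous
(`lowerSemicontinuous_levelSetCapillary`). The functional on sets is its restriction to
characteristic functions.

Conversely, if `|β| > 1` on a set of positive measure, Lebesgue differentiation gives a cube `Q`
with `∫_Q β > |Q|` or `∫_Q β < -|Q|`. In the first case the thin slabs `Q × (0, 1/k]` converge to
the empty set, while their energies have upper limit at most `|Q| - ∫_Q β < 0`
(`setIntegral_cube_le`). In the second case the slabs `Q × (1/k, 1 + 1/k]` converge to `Q × (0, 1]`;
detaching the slab from the boundary adds at most `|Q|` to the perimeter and removes the boundary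
term, which exceeds `|Q|` (`neg_le_setIntegral_cube`).
-/

namespace Capillary

/-! ### Coordinates of the half-space -/

/-- The splitting `ℝⁿ⁺¹ = ℝⁿ × ℝ` into horizontal coordinates and height. -/
noncomputable def split (n : ℕ) :
    EuclideanSpace ℝ (Fin (n + 1)) ≃L[ℝ] EuclideanSpace ℝ (Fin n) × ℝ :=
  LinearEquiv.toContinuousLinearEquiv
    { toFun := fun x => (WithLp.toLp 2 fun i => x i.castSucc, x (Fin.last n))
      invFun := fun p => WithLp.toLp 2 (Fin.snoc (α := fun _ => ℝ) (fun i => p.1 i) p.2)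
      map_add' := fun _ _ => rfl
      map_smul' := fun _ _ => rfl
      left_inv := fun x => by
        ext i
        refine Fin.lastCases ?_ (fun j => ?_) i <;> simp
      right_inv := fun p => by
        ext <;> simp }

variable {n : ℕ}

lemma split_snd (x : EuclideanSpace ℝ (Fin (n + 1))) : (split n x).2 = x (Fin.last n) := rfl

lemma split_fst_apply (x : EuclideanSpace ℝ (Fin (n + 1))) (i : Fin n) :
    (split n x).1 i = x i.castSucc := rfl

lemma split_symm_apply (y : EuclideanSpace ℝ (Fin n)) (t : ℝ) :
    (split n).symm (y, t) = WithLp.toLp 2 (Fin.snoc (α := fun _ => ℝ) (fun i => y i) t) := rfl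

@[simp]
lemma split_symm_apply_last (p : EuclideanSpace ℝ (Fin n) × ℝ) :
    (split n).symm p (Fin.last n) = p.2 := by
  rw [← Prod.mk.eta (p := p), split_symm_apply]
  simp

@[simp]
lemma split_symm_apply_castSucc (p : EuclideanSpace ℝ (Fin n) × ℝ) (i : Fin n) :
    (split n).symm p i.castSucc = p.1 i := by
  rw [← Prod.mk.eta (p := p), split_symm_apply]
  simp

lemma boundaryPoint_eq (y : EuclideanSpace ℝ (Fin n)) :
    boundaryPoint y = (split n).symm (y, 0) := rfl

/-- The upward unit vector. -/
noncomputable def up (n : ℕ) : EuclideanSpace ℝ (Fin (n + 1)) :=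
  EuclideanSpace.single (Fin.last n) 1

lemma split_up : split n (up n) = (0, 1) := by
  ext i
  · simp [split_fst_apply, up, Fin.castSucc_ne_last]
  · simp [split_snd, up]

lemma split_symm_zero_one : (split n).symm (0, 1) = up n := by
  rw [← split_up, ContinuousLinearEquiv.symm_apply_apply]

lemma norm_up : ‖up n‖ = 1 := by simp [up]

lemma norm_sq_eq_split (x : EuclideanSpace ℝ (Fin (n + 1))) :
    ‖x‖ ^ 2 = ‖(split n x).1‖ ^ 2 + (split n x).2 ^ 2 := by
  simp [EuclideanSpace.norm_sq_eq, Fin.sum_univ_castSucc, split_fst_apply, split_snd]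

lemma measurePreserving_split_symm :
    MeasurePreserving (split n).symm (volume : Measure (EuclideanSpace ℝ (Fin n) × ℝ)) volume := by
  have h1 : MeasurePreserving
      (fun p : EuclideanSpace ℝ (Fin n) × ℝ => (p.2, WithLp.ofLp p.1)) :=
    ((MeasurePreserving.id volume).prod (PiLp.volume_preserving_ofLp (Fin n))).comp
      Measure.measurePreserving_swap
  have h2 := ((PiLp.volume_preserving_toLp (Fin (n + 1))).comp
    (volume_preserving_piFinSuccAbove (fun _ : Fin (n + 1) => ℝ) (Fin.last n)).symm).comp h1
  have h3 : ⇑(split n).symm = (WithLp.toLp 2 ∘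
      (MeasurableEquiv.piFinSuccAbove (fun _ : Fin (n + 1) => ℝ) (Fin.last n)).symm) ∘
        fun p : EuclideanSpace ℝ (Fin n) × ℝ => (p.2, WithLp.ofLp p.1) := by
    ext p i
    refine Fin.lastCases ?_ (fun j => ?_) i
    · simp [MeasurableEquiv.piFinSuccAbove]
    · simp [MeasurableEquiv.piFinSuccAbove]
  rw [h3]
  exact h2

lemma measurableEmbedding_split_symm : MeasurableEmbedding (split n).symm :=
  (split n).symm.toHomeomorph.measurableEmbedding

lemma integral_split (f : EuclideanSpace ℝ (Fin (n + 1)) → ℝ) :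
    ∫ x, f x = ∫ p : EuclideanSpace ℝ (Fin n) × ℝ, f ((split n).symm p) :=
  (measurePreserving_split_symm.integral_comp measurableEmbedding_split_symm f).symm

lemma integrable_split_iff {f : EuclideanSpace ℝ (Fin (n + 1)) → ℝ} :
    Integrable (fun p : EuclideanSpace ℝ (Fin n) × ℝ => f ((split n).symm p)) ↔ Integrable f :=
  measurePreserving_split_symm.integrable_comp_emb measurableEmbedding_split_symm

lemma volume_preimage_split (s : Set (EuclideanSpace ℝ (Fin n) × ℝ)) :
    volume (split n ⁻¹' s) = volume s := by
  rw [← measurePreserving_split_symm.measure_preimage_emb measurableEmbedding_split_symm]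
  congr 1
  ext p
  simp

lemma isOpen_halfSpace : IsOpen (halfSpace n) :=
  isOpen_lt continuous_const (continuous_snd.comp (split n).continuous)

/-- The open cylinder `U × (0, r)` over `U ⊆ ℝⁿ`. -/
def cylinder (U : Set (EuclideanSpace ℝ (Fin n))) (r : ℝ) :
    Set (EuclideanSpace ℝ (Fin (n + 1))) :=
  split n ⁻¹' (U ×ˢ Set.Ioo 0 r)

lemma mem_cylinder {U : Set (EuclideanSpace ℝ (Fin n))} {r : ℝ}
    {x : EuclideanSpace ℝ (Fin (n + 1))} :
    x ∈ cylinder U r ↔ (split n x).1 ∈ U ∧ 0 < (split n x).2 ∧ (split n x).2 < r := Iff.rfl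

lemma isOpen_cylinder {U : Set (EuclideanSpace ℝ (Fin n))} (hU : IsOpen U) (r : ℝ) :
    IsOpen (cylinder U r) :=
  (hU.prod isOpen_Ioo).preimage (split n).continuous

lemma cylinder_subset_halfSpace (U : Set (EuclideanSpace ℝ (Fin n))) (r : ℝ) :
    cylinder U r ⊆ halfSpace n := fun _ hx => hx.2.1

lemma cylinder_mono {U V : Set (EuclideanSpace ℝ (Fin n))} (h : U ⊆ V) {r s : ℝ} (hrs : r ≤ s) :
    cylinder U r ⊆ cylinder V s := fun _ hx => ⟨h hx.1, hx.2.1, hx.2.2.trans_le hrs⟩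

/-! ### Vertical test fields and vertical antiderivatives -/

lemma divergence_smul_up {ψ : EuclideanSpace ℝ (Fin (n + 1)) → ℝ} (hψ : ContDiff ℝ 1 ψ)
    (x : EuclideanSpace ℝ (Fin (n + 1))) :
    divergence (fun x => ψ x • up n) x = fderiv ℝ ψ x (up n) := by
  have h : fderiv ℝ (fun x => ψ x • up n) x = (fderiv ℝ ψ x).smulRight (up n) :=
    (((hψ.differentiable one_ne_zero) x).hasFDerivAt.smul_const (up n)).fderiv
  rw [divergence, h, Fin.sum_univ_castSucc]
  simp [up, Fin.castSucc_ne_last]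

/-- A parametric integral over `[0, 1]` of a `C¹` function is `C¹`. -/
lemma contDiff_one_integral_unitInterval {E : Type*} [NormedAddCommGroup E] [NormedSpace ℝ E]
    [FiniteDimensional ℝ E] {F : E × ℝ → ℝ} (hF : ContDiff ℝ 1 F) :
    ContDiff ℝ 1 fun x => ∫ s in (0 : ℝ)..1, F (x, s) := by
  set F' : E → ℝ → E →L[ℝ] ℝ := fun x s =>
    (fderiv ℝ F (x, s)).comp (ContinuousLinearMap.inl ℝ E ℝ) with hF'
  have hF'c : Continuous (Function.uncurry F') := by
    have h1 : Continuous fun p : E × ℝ => fderiv ℝ F p := hF.continuous_fderiv one_ne_zero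
    exact (h1.clm_comp continuous_const)
  have hder : ∀ x, HasFDerivAt (fun x => ∫ s in (0 : ℝ)..1, F (x, s))
      (∫ s in (0 : ℝ)..1, F' x s) x := by
    intro x
    have hcomp : IsCompact ((Metric.closedBall x 1) ×ˢ Set.Icc (0 : ℝ) 1) :=
      (isCompact_closedBall x 1).prod isCompact_Icc
    obtain ⟨C, hC⟩ := hcomp.exists_bound_of_continuousOn hF'c.continuousOn
    refine (intervalIntegral.hasFDerivAt_integral_of_dominated_of_fderiv_le
      (F := fun x s => F (x, s)) (F' := F') (bound := fun _ => C) (s := Metric.ball x 1)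
      (Metric.ball_mem_nhds x one_pos) ?_ ?_ ?_ ?_ ?_ ?_)
    · exact Eventually.of_forall fun y =>
        (hF.continuous.comp (by fun_prop : Continuous fun s : ℝ => (y, s))).aestronglyMeasurable
    · exact (hF.continuous.comp
        (by fun_prop : Continuous fun s : ℝ => (x, s))).intervalIntegrable _ _
    · exact (hF'c.comp (by fun_prop : Continuous fun s : ℝ => (x, s))).aestronglyMeasurable
    · refine Eventually.of_forall fun s hs y hy => ?_
      rw [Set.uIoc_of_le zero_le_one] at hs
      exact hC (y, s) ⟨Metric.ball_subset_closedBall hy, hs.1.le, hs.2⟩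
    · simp
    · refine Eventually.of_forall fun s hs y hy => ?_
      have h1 : HasFDerivAt F (fderiv ℝ F (y, s)) (y, s) :=
        (hF.differentiable one_ne_zero _).hasFDerivAt
      exact h1.comp y (hasFDerivAt_prodMk_left y s)
  rw [contDiff_one_iff_fderiv]
  refine ⟨fun x => (hder x).differentiableAt, ?_⟩
  have : fderiv ℝ (fun x => ∫ s in (0 : ℝ)..1, F (x, s)) = fun x => ∫ s in (0 : ℝ)..1, F' x s :=
    funext fun x => (hder x).fderiv
  rw [this]
  exact intervalIntegral.continuous_parametric_intervalIntegral_of_continuous' hF'c 0 1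

/-- The antiderivative of `g` in the vertical direction which vanishes on `∂Ω`. -/
noncomputable def verticalPrimitive (g : EuclideanSpace ℝ (Fin (n + 1)) → ℝ)
    (x : EuclideanSpace ℝ (Fin (n + 1))) : ℝ :=
  ∫ t in (0 : ℝ)..(split n x).2, g ((split n).symm ((split n x).1, t))

lemma contDiff_verticalPrimitive {g : EuclideanSpace ℝ (Fin (n + 1)) → ℝ} (hg : ContDiff ℝ 1 g) :
    ContDiff ℝ 1 (verticalPrimitive g) := by
  -- Rescale the interval of integration to `[0, 1]`.
  have h : verticalPrimitive g = fun x => (split n x).2 *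
      ∫ s in (0 : ℝ)..1, g ((split n).symm ((split n x).1, (split n x).2 * s)) := by
    funext x
    have := intervalIntegral.smul_integral_comp_mul_left (a := 0) (b := 1)
      (fun t => g ((split n).symm ((split n x).1, t))) (split n x).2
    rw [smul_eq_mul, mul_zero, mul_one] at this
    exact this.symm
  rw [h]
  have hs : ContDiff ℝ 1 (split n) := (split n).contDiff
  refine hs.snd.mul (contDiff_one_integral_unitInterval (F := fun p =>
    g ((split n).symm ((split n p.1).1, (split n p.1).2 * p.2))) ?_)
  refine hg.comp ((split n).symm.contDiff.comp ?_)
  have h1 : ContDiff ℝ 1 fun p : EuclideanSpace ℝ (Fin (n + 1)) × ℝ => split n p.1 :=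
    hs.comp contDiff_fst
  exact h1.fst.prodMk (h1.snd.mul contDiff_snd)

lemma split_add_smul_up (x : EuclideanSpace ℝ (Fin (n + 1))) (s : ℝ) :
    split n (x + s • up n) = ((split n x).1, (split n x).2 + s) := by
  rw [map_add, map_smul, split_up]
  ext <;> simp

/-- A derivative in the vertical direction may be computed along the vertical line. -/
lemma fderiv_up_eq_of_hasDerivAt {ψ : EuclideanSpace ℝ (Fin (n + 1)) → ℝ} (hψ : ContDiff ℝ 1 ψ)
    {x : EuclideanSpace ℝ (Fin (n + 1))} {d : ℝ}
    (h : HasDerivAt (fun t => ψ ((split n).symm ((split n x).1, t))) d (split n x).2) :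
    fderiv ℝ ψ x (up n) = d := by
  have h1 : HasDerivAt (fun t : ℝ => (split n).symm ((split n x).1, t)) (up n) (split n x).2 := by
    have : HasDerivAt (fun t : ℝ => ((split n x).1, t)) (0, 1) (split n x).2 :=
      (hasDerivAt_const _ _).prodMk (hasDerivAt_id _)
    have h3 := (split n).symm.hasFDerivAt.comp_hasDerivAt _ this
    rw [← split_symm_zero_one]
    exact h3
  have h2 : HasFDerivAt ψ (fderiv ℝ ψ x) ((split n).symm ((split n x).1, (split n x).2)) := by
    rw [Prod.mk.eta, ContinuousLinearEquiv.symm_apply_apply]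
    exact (hψ.differentiable one_ne_zero x).hasFDerivAt
  exact (h2.comp_hasDerivAt _ h1).unique h

/-! ### The `L¹` norm by duality with test functions -/

section Duality

variable {E : Type*} [NormedAddCommGroup E] [NormedSpace ℝ E] [FiniteDimensional ℝ E]

lemma exists_contDiff_one_of_isCompact_subset {K V : Set E} (hK : IsCompact K) (hV : IsOpen V)
    (hKV : K ⊆ V) :
    ∃ g : E → ℝ, ContDiff ℝ 1 g ∧ HasCompactSupport g ∧ tsupport g ⊆ V ∧
      (∀ x, g x ∈ Set.Icc (0 : ℝ) 1) ∧ ∀ x ∈ K, g x = 1 := by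
  obtain ⟨L, hL, hKL, hLV⟩ := exists_compact_between hK hV hKV
  obtain ⟨g, hg, hgr, hgs, hg1⟩ := exists_contMDiff_support_eq_eq_one_iff (n := 1)
    (modelWithCornersSelf ℝ E) isOpen_interior hK.isClosed hKL
  have hts : tsupport g ⊆ L := by
    rw [tsupport, hgs]
    exact closure_minimal interior_subset hL.isClosed
  exact ⟨g, hg.contDiff, hL.of_isClosed_subset (isClosed_tsupport g) hts, hts.trans hLV,
    fun x => hgr ⟨x, rfl⟩, fun x hx => (hg1 x).1 hx⟩

variable [MeasurableSpace E] [BorelSpace E] {μ : Measure E}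

/-- Auxiliary form of `setIntegral_abs_le_of_forall_test` for measurable functions. The sign of `f`
is realised by a test function up to a set on which `|f|` has small integral. -/
lemma setIntegral_abs_le_of_forall_test_aux {f : E → ℝ} (hf : Integrable f μ)
    (hfm : Measurable f) {U : Set E} (hU : IsOpen U) {C : ℝ}
    (h : ∀ g : E → ℝ, ContDiff ℝ 1 g → HasCompactSupport g → tsupport g ⊆ U →
      (∀ x, |g x| ≤ 1) → ∫ x, g x * f x ∂μ ≤ C) :
    ∫ x in U, |f x| ∂μ ≤ C := by
  refine le_of_forall_pos_le_add fun ε hε => ?_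
  set ν : Measure E := μ.withDensity fun x => ‖f x‖ₑ with hν
  have : IsFiniteMeasure ν := isFiniteMeasure_withDensity hf.2.ne
  have key : ∀ A : Set E, MeasurableSet A → ∃ K ⊆ A, IsCompact K ∧
      ∫ x in A \ K, |f x| ∂μ ≤ ε / 4 := by
    intro A hA
    obtain ⟨K, hKA, hK, hlt⟩ := hA.exists_isCompact_sdiff_lt (μ := ν) (measure_ne_top ν A)
      (ε := ENNReal.ofReal (ε / 4)) (by simpa using hε)
    refine ⟨K, hKA, hK, ?_⟩
    rw [withDensity_apply _ (hA.diff hK.measurableSet)] at hlt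
    have h1 : ∫ x in A \ K, |f x| ∂μ = (∫⁻ x in A \ K, ‖f x‖ₑ ∂μ).toReal :=
      integral_norm_eq_lintegral_enorm hf.1.restrict
    rw [h1]
    exact (ENNReal.toReal_mono ENNReal.ofReal_ne_top hlt.le).trans_eq
      (ENNReal.toReal_ofReal (by positivity))
  have hAp : MeasurableSet (U ∩ {x | 0 < f x}) :=
    hU.measurableSet.inter (measurableSet_lt measurable_const hfm)
  have hAm : MeasurableSet (U ∩ {x | f x < 0}) :=
    hU.measurableSet.inter (measurableSet_lt hfm measurable_const)
  obtain ⟨Kp, hKp, hKpc, hKpi⟩ := key _ hAp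
  obtain ⟨Km, hKm, hKmc, hKmi⟩ := key _ hAm
  -- The test function is `1` on `Kp` and `-1` on `Km`.
  have hdisj : Disjoint Kp Km := Set.disjoint_left.2 fun x hx hx' =>
    lt_asymm (show 0 < f x from (hKp hx).2) (hKm hx').2
  obtain ⟨Vp, Vm, hVp, hVm, hKVp, hKVm, hVV⟩ := SeparatedNhds.of_isCompact_isCompact hKpc hKmc hdisj
  obtain ⟨gp, gp1, gp2, gp3, gp4, gp5⟩ := exists_contDiff_one_of_isCompact_subset hKpc
    (hVp.inter hU) (Set.subset_inter hKVp fun x hx => (hKp hx).1)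
  obtain ⟨gm, gm1, gm2, gm3, gm4, gm5⟩ := exists_contDiff_one_of_isCompact_subset hKmc
    (hVm.inter hU) (Set.subset_inter hKVm fun x hx => (hKm hx).1)
  have hzero : ∀ x, gp x = 0 ∨ gm x = 0 := by
    intro x
    by_contra! hx
    exact Set.disjoint_left.1 hVV (gp3 (subset_tsupport _ hx.1)).1 (gm3 (subset_tsupport _ hx.2)).1
  set g : E → ℝ := gp - gm with hg
  have hgabs : ∀ x, |g x| ≤ 1 := by
    intro x
    rw [hg, Pi.sub_apply, abs_le]
    constructor <;> linarith [(gp4 x).1, (gp4 x).2, (gm4 x).1, (gm4 x).2]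
  have hgsupp : tsupport g ⊆ U := (tsupport_sub gp gm).trans
    (Set.union_subset (gp3.trans Set.inter_subset_right) (gm3.trans Set.inter_subset_right))
  have hgc : HasCompactSupport g := gp2.sub gm2
  have hgf := h g (gp1.sub gm1) hgc hgsupp hgabs
  have hgU : ∫ x, g x * f x ∂μ = ∫ x in U, g x * f x ∂μ := by
    refine (setIntegral_eq_integral_of_forall_compl_eq_zero fun x hx => ?_).symm
    rw [image_eq_zero_of_notMem_tsupport fun h => hx (hgsupp h), zero_mul]
  have higf : Integrable (fun x => g x * f x) μ :=
    hf.bdd_mul (c := 1) (gp1.sub gm1).continuous.aestronglyMeasurable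
      (Eventually.of_forall hgabs)
  have hip := (hf.abs.indicator (hAp.diff hKpc.measurableSet))
  have him := (hf.abs.indicator (hAm.diff hKmc.measurableSet))
  have hle : ∫ x in U, (|f x| - g x * f x) ∂μ ≤
      ∫ x in U, (2 * ((U ∩ {x | 0 < f x}) \ Kp).indicator (fun x => |f x|) x +
        2 * ((U ∩ {x | f x < 0}) \ Km).indicator (fun x => |f x|) x) ∂μ := by
    refine setIntegral_mono_on (hf.abs.sub higf).integrableOn
      ((hip.const_mul 2).add (him.const_mul 2)).integrableOn hU.measurableSet fun x hx => ?_
    have h1 : |f x| - g x * f x ≤ 2 * |f x| := by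
      have := neg_abs_le (g x * f x)
      rw [abs_mul] at this
      nlinarith [hgabs x, abs_nonneg (f x), abs_nonneg (g x)]
    rcases lt_trichotomy (f x) 0 with h0 | h0 | h0
    · have h2 : x ∉ (U ∩ {x | 0 < f x}) \ Kp := fun hh => lt_asymm hh.1.2 h0
      rw [Set.indicator_of_notMem h2]
      by_cases hxK : x ∈ Km
      · have h3 : x ∉ (U ∩ {x | f x < 0}) \ Km := fun hh => hh.2 hxK
        have h4 : gp x = 0 := (hzero x).resolve_right (by rw [gm5 x hxK]; exact one_ne_zero)
        rw [Set.indicator_of_notMem h3, hg, Pi.sub_apply, h4, gm5 x hxK, abs_of_neg h0]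
        linarith
      · rw [Set.indicator_of_mem (show x ∈ (U ∩ {x | f x < 0}) \ Km from ⟨⟨hx, h0⟩, hxK⟩)]
        linarith
    · simp [h0, Set.indicator]
    · have h2 : x ∉ (U ∩ {x | f x < 0}) \ Km := fun hh => lt_asymm hh.1.2 h0
      rw [Set.indicator_of_notMem h2]
      by_cases hxK : x ∈ Kp
      · have h3 : x ∉ (U ∩ {x | 0 < f x}) \ Kp := fun hh => hh.2 hxK
        have h4 : gm x = 0 := (hzero x).resolve_left (by rw [gp5 x hxK]; exact one_ne_zero)
        rw [Set.indicator_of_notMem h3, hg, Pi.sub_apply, h4, gp5 x hxK, abs_of_pos h0]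
        linarith
      · rw [Set.indicator_of_mem (show x ∈ (U ∩ {x | 0 < f x}) \ Kp from ⟨⟨hx, h0⟩, hxK⟩)]
        linarith
  rw [integral_sub hf.abs.integrableOn higf.integrableOn,
    integral_add (hip.const_mul 2).integrableOn (him.const_mul 2).integrableOn,
    integral_const_mul, integral_const_mul,
    setIntegral_indicator (hAp.diff hKpc.measurableSet),
    setIntegral_indicator (hAm.diff hKmc.measurableSet)] at hle
  have e1 : U ∩ ((U ∩ {x | 0 < f x}) \ Kp) = (U ∩ {x | 0 < f x}) \ Kp :=
    Set.inter_eq_right.2 fun x hx => hx.1.1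
  have e2 : U ∩ ((U ∩ {x | f x < 0}) \ Km) = (U ∩ {x | f x < 0}) \ Km :=
    Set.inter_eq_right.2 fun x hx => hx.1.1
  rw [e1, e2] at hle
  linarith

/-- The integral of `|f|` over an open set `U` is the supremum of `∫ g f` over the `C¹` functions
`g` with compact support in `U` and `|g| ≤ 1`. -/
lemma setIntegral_abs_le_of_forall_test {f : E → ℝ} (hf : Integrable f μ)
    {U : Set E} (hU : IsOpen U) {C : ℝ}
    (h : ∀ g : E → ℝ, ContDiff ℝ 1 g → HasCompactSupport g → tsupport g ⊆ U →
      (∀ x, |g x| ≤ 1) → ∫ x, g x * f x ∂μ ≤ C) :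
    ∫ x in U, |f x| ∂μ ≤ C := by
  have hae := hf.1.ae_eq_mk
  have h1 : ∫ x in U, |f x| ∂μ = ∫ x in U, |hf.1.mk f x| ∂μ :=
    integral_congr_ae (ae_restrict_of_ae (hae.mono fun x hx => by simp only [hx]))
  rw [h1]
  refine setIntegral_abs_le_of_forall_test_aux (hf.congr hae) hf.1.stronglyMeasurable_mk.measurable
    hU fun g g1 g2 g3 g4 => ?_
  refine le_of_eq_of_le (integral_congr_ae (hae.mono fun x hx => ?_)) (h g g1 g2 g3 g4)
  simp only [hx]

end Duality

/-! ### Total variation -/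

section TotalVariation

variable {d : ℕ}

lemma continuous_divergence {φ : EuclideanSpace ℝ (Fin d) → EuclideanSpace ℝ (Fin d)}
    (hφ : ContDiff ℝ 1 φ) : Continuous (divergence φ) :=
  continuous_finsetSum _ fun i _ => (EuclideanSpace.proj (𝕜 := ℝ) i).continuous.comp
    ((hφ.continuous_fderiv one_ne_zero).clm_apply continuous_const)

lemma divergence_add {φ χ : EuclideanSpace ℝ (Fin d) → EuclideanSpace ℝ (Fin d)}
    (hφ : ContDiff ℝ 1 φ) (hχ : ContDiff ℝ 1 χ) (x : EuclideanSpace ℝ (Fin d)) :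
    divergence (φ + χ) x = divergence φ x + divergence χ x := by
  simp only [divergence]
  rw [fderiv_add (hφ.differentiable one_ne_zero x) (hχ.differentiable one_ne_zero x),
    ← Finset.sum_add_distrib]
  rfl

lemma divergence_eq_zero_of_notMem {φ : EuclideanSpace ℝ (Fin d) → EuclideanSpace ℝ (Fin d)}
    {x : EuclideanSpace ℝ (Fin d)} (hx : x ∉ tsupport φ) : divergence φ x = 0 := by
  have h : fderiv ℝ φ x = 0 := by
    by_contra h
    exact hx (support_fderiv_subset ℝ h)
  simp [divergence, h]

lemma exists_bound_divergence {φ : EuclideanSpace ℝ (Fin d) → EuclideanSpace ℝ (Fin d)}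
    (hφ : ContDiff ℝ 1 φ) (hc : HasCompactSupport φ) : ∃ C, ∀ x, ‖divergence φ x‖ ≤ C := by
  refine HasCompactSupport.exists_bound_of_continuous ?_ (continuous_divergence hφ)
  exact HasCompactSupport.intro hc fun x hx => divergence_eq_zero_of_notMem hx

lemma integrable_mul_divergence {u : EuclideanSpace ℝ (Fin d) → ℝ} (hu : Integrable u)
    {φ : EuclideanSpace ℝ (Fin d) → EuclideanSpace ℝ (Fin d)}
    (hφ : ContDiff ℝ 1 φ) (hc : HasCompactSupport φ) :
    Integrable fun x => u x * divergence φ x := by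
  obtain ⟨C, hC⟩ := exists_bound_divergence hφ hc
  exact hu.mul_bdd (c := C) (continuous_divergence hφ).aestronglyMeasurable
    (Eventually.of_forall hC)

variable {U V : Set (EuclideanSpace ℝ (Fin d))} {u : EuclideanSpace ℝ (Fin d) → ℝ}

lemma IsTestField.mono {φ : EuclideanSpace ℝ (Fin d) → EuclideanSpace ℝ (Fin d)}
    (h : IsTestField U φ) (hUV : U ⊆ V) : IsTestField V φ :=
  { h with tsupport_subset := h.tsupport_subset.trans hUV }

lemma setIntegral_mul_divergence {φ : EuclideanSpace ℝ (Fin d) → EuclideanSpace ℝ (Fin d)}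
    (h : tsupport φ ⊆ U) :
    ∫ x in U, u x * divergence φ x = ∫ x, u x * divergence φ x :=
  setIntegral_eq_integral_of_forall_compl_eq_zero fun x hx => by
    rw [divergence_eq_zero_of_notMem fun hx' => hx (h hx'), mul_zero]

lemma IsTestField.ofReal_integral_le {φ : EuclideanSpace ℝ (Fin d) → EuclideanSpace ℝ (Fin d)}
    (h : IsTestField U φ) :
    ENNReal.ofReal (∫ x, u x * divergence φ x) ≤ totalVariation U u := by
  rw [← setIntegral_mul_divergence h.tsupport_subset]
  exact le_iSup₂ (f := fun (φ : EuclideanSpace ℝ (Fin d) → EuclideanSpace ℝ (Fin d))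
    (_ : IsTestField U φ) => ENNReal.ofReal (∫ x in U, u x * divergence φ x)) φ h

lemma IsTestField.integral_le {φ : EuclideanSpace ℝ (Fin d) → EuclideanSpace ℝ (Fin d)}
    (h : IsTestField U φ) (hu : totalVariation U u < ∞) :
    ∫ x, u x * divergence φ x ≤ (totalVariation U u).toReal :=
  (ENNReal.ofReal_le_iff_le_toReal hu.ne).1 h.ofReal_integral_le

lemma totalVariation_le {C : ℝ≥0∞}
    (h : ∀ φ : EuclideanSpace ℝ (Fin d) → EuclideanSpace ℝ (Fin d), IsTestField U φ →
      ENNReal.ofReal (∫ x, u x * divergence φ x) ≤ C) : totalVariation U u ≤ C :=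
  iSup₂_le fun φ hφ => by
    rw [setIntegral_mul_divergence hφ.tsupport_subset]
    exact h φ hφ

lemma totalVariation_mono (h : U ⊆ V) : totalVariation U u ≤ totalVariation V u :=
  totalVariation_le fun _ hφ => (hφ.mono h).ofReal_integral_le

lemma isTestField_zero : IsTestField U (0 : EuclideanSpace ℝ (Fin d) → EuclideanSpace ℝ (Fin d)) :=
  ⟨contDiff_const, HasCompactSupport.zero, by simp [tsupport], by simp⟩

lemma totalVariation_indicator (hU : MeasurableSet U) (h : U ⊆ V) :
    totalVariation U (V.indicator u) = totalVariation U u := by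
  simp only [totalVariation]
  have h1 : ∀ φ : EuclideanSpace ℝ (Fin d) → EuclideanSpace ℝ (Fin d),
      ∫ x in U, V.indicator u x * divergence φ x = ∫ x in U, u x * divergence φ x := fun φ =>
    setIntegral_congr_fun hU fun x hx => by
      rw [Set.indicator_of_mem (h hx)]
  simp only [h1]

lemma IsTestField.add {φ χ : EuclideanSpace ℝ (Fin d) → EuclideanSpace ℝ (Fin d)}
    (hφ : IsTestField U φ) (hχ : IsTestField V χ) (hUV : Disjoint U V) :
    IsTestField (U ∪ V) (φ + χ) where
  contDiff := hφ.contDiff.add hχ.contDiff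
  hasCompactSupport := hφ.hasCompactSupport.add hχ.hasCompactSupport
  tsupport_subset := (tsupport_add φ χ).trans
    (Set.union_subset_union hφ.tsupport_subset hχ.tsupport_subset)
  norm_le_one x := by
    by_cases hx : x ∈ tsupport φ
    · have : χ x = 0 := image_eq_zero_of_notMem_tsupport fun hx' =>
        Set.disjoint_left.1 hUV (hφ.tsupport_subset hx) (hχ.tsupport_subset hx')
      simpa [this] using hφ.norm_le_one x
    · simpa [image_eq_zero_of_notMem_tsupport hx] using hχ.norm_le_one x

/-- The total variation is superadditive on disjoint sets: test fields with disjoint supports may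
be added. -/
lemma totalVariation_add_le (hu : Integrable u) (hUV : Disjoint U V) :
    totalVariation U u + totalVariation V u ≤ totalVariation (U ∪ V) u := by
  refine ENNReal.biSup_add_biSup_le' ⟨0, isTestField_zero⟩ ⟨0, isTestField_zero⟩ ?_
  intro φ hφ χ hχ
  rw [setIntegral_mul_divergence hφ.tsupport_subset, setIntegral_mul_divergence hχ.tsupport_subset]
  rcases le_total (∫ x, u x * divergence φ x) 0 with h1 | h1
  · rw [ENNReal.ofReal_of_nonpos h1, zero_add]
    exact (hχ.mono Set.subset_union_right).ofReal_integral_le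
  rcases le_total (∫ x, u x * divergence χ x) 0 with h2 | h2
  · rw [ENNReal.ofReal_of_nonpos h2, add_zero]
    exact (hφ.mono Set.subset_union_left).ofReal_integral_le
  rw [← ENNReal.ofReal_add h1 h2, ← integral_add
    (integrable_mul_divergence hu hφ.contDiff hφ.hasCompactSupport)
    (integrable_mul_divergence hu hχ.contDiff hχ.hasCompactSupport)]
  refine le_of_eq_of_le ?_ (hφ.add hχ hUV).ofReal_integral_le
  congr 2
  funext x
  rw [divergence_add hφ.contDiff hχ.contDiff, mul_add]

lemma sum_totalVariation_le {ι : Type*} (hu : Integrable u)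
    {U : ι → Set (EuclideanSpace ℝ (Fin d))} (s : Finset ι)
    (hd : (s : Set ι).PairwiseDisjoint U) :
    ∑ i ∈ s, totalVariation (U i) u ≤ totalVariation (⋃ i ∈ s, U i) u := by
  classical
  induction s using Finset.induction_on with
  | empty => simp
  | insert a s ha ih =>
    rw [Finset.sum_insert ha, Finset.set_biUnion_insert]
    refine (add_le_add_right (ih (hd.subset (by simp))) _).trans (totalVariation_add_le hu ?_)
    rw [Set.disjoint_iUnion₂_right]
    intro i hi
    exact hd (by simp) (by simp [hi]) fun h => ha (h ▸ hi)

end TotalVariation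

variable {u : EuclideanSpace ℝ (Fin (n + 1)) → ℝ}

/-- The total variation bounds the integral against vertical derivatives of scalar functions. -/
lemma integral_mul_fderiv_up_le {U : Set (EuclideanSpace ℝ (Fin (n + 1)))}
    (hTV : totalVariation U u < ∞) {ψ : EuclideanSpace ℝ (Fin (n + 1)) → ℝ}
    (hψ : ContDiff ℝ 1 ψ) (hc : HasCompactSupport ψ) (hs : tsupport ψ ⊆ U) {M : ℝ} (hM : 0 < M)
    (hb : ∀ x, |ψ x| ≤ M) :
    ∫ x, u x * fderiv ℝ ψ x (up n) ≤ M * (totalVariation U u).toReal := by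
  have hψ' : ContDiff ℝ 1 fun x => M⁻¹ * ψ x := contDiff_const.mul hψ
  have hsub : (tsupport fun x => (M⁻¹ * ψ x) • up n) ⊆ tsupport ψ := by
    refine closure_mono fun x hx hx0 => hx ?_
    simp [hx0]
  have ht : IsTestField U fun x => (M⁻¹ * ψ x) • up n :=
    { contDiff := hψ'.smul contDiff_const
      hasCompactSupport := hc.of_isClosed_subset (isClosed_tsupport _) hsub
      tsupport_subset := hsub.trans hs
      norm_le_one := fun x => by
        rw [norm_smul, norm_up, mul_one, norm_mul, norm_inv, Real.norm_eq_abs, Real.norm_eq_abs,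
          abs_of_pos hM, inv_mul_le_one₀ hM]
        exact hb x }
  have h := ht.integral_le hTV
  have h2 : ∀ x, u x * divergence (fun x => (M⁻¹ * ψ x) • up n) x =
      M⁻¹ * (u x * fderiv ℝ ψ x (up n)) := by
    intro x
    rw [divergence_smul_up hψ', fderiv_const_mul (hψ.differentiable one_ne_zero x)]
    simp only [FunLike.coe_smul, Pi.smul_apply, smul_eq_mul]
    ring
  simp only [h2] at h
  rw [integral_const_mul, inv_mul_le_iff₀ hM] at h
  exact h

lemma IsTestField.exists_height_lt {φ : EuclideanSpace ℝ (Fin (n + 1)) →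
    EuclideanSpace ℝ (Fin (n + 1))} (h : IsTestField (halfSpace n) φ) :
    ∃ ε > 0, tsupport φ ⊆ {x | ε < (split n x).2} := by
  have hcont : ContinuousOn (fun x => (split n x).2) (tsupport φ) :=
    (continuous_snd.comp (split n).continuous).continuousOn
  rcases (tsupport φ).eq_empty_or_nonempty with h0 | h0
  · exact ⟨1, one_pos, by simp [h0]⟩
  · obtain ⟨x, hx, hmin⟩ := h.hasCompactSupport.isCompact.exists_isMinOn h0 hcont
    have hpos : 0 < (split n x).2 := h.tsupport_subset hx
    exact ⟨(split n x).2 / 2, by positivity, fun y hy => (half_lt_self hpos).trans_le (hmin hy)⟩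

/-- The total variation in a thin layer at the boundary and the pairing with a test field supported
above it add up to at most the total variation in the half-space. -/
lemma totalVariation_cylinder_add_le (hu : Integrable u)
    {φ : EuclideanSpace ℝ (Fin (n + 1)) → EuclideanSpace ℝ (Fin (n + 1))}
    (hφ : IsTestField (halfSpace n) φ) {ε : ℝ} (h0 : 0 < ε)
    (hε : tsupport φ ⊆ {x | ε < (split n x).2}) :
    totalVariation (cylinder Set.univ ε) u + ENNReal.ofReal (∫ x, u x * divergence φ x) ≤
      totalVariation (halfSpace n) u := by
  have hφ' : IsTestField {x | ε < (split n x).2} φ := { hφ with tsupport_subset := hε }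
  have hd : Disjoint (cylinder Set.univ ε) {x : EuclideanSpace ℝ (Fin (n + 1)) |
      ε < (split n x).2} :=
    Set.disjoint_left.2 fun x hx hx' => lt_asymm hx.2.2 hx'
  refine (add_le_add_right hφ'.ofReal_integral_le _).trans
    ((totalVariation_add_le hu hd).trans (totalVariation_mono ?_))
  exact Set.union_subset (cylinder_subset_halfSpace _ _) fun x hx => h0.trans hx

/-- The total variation in the layer `0 < t < ε` tends to `0` as `ε → 0`. -/
lemma tendsto_totalVariation_cylinder (hu : Integrable u)
    (hTV : totalVariation (halfSpace n) u < ∞) :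
    Tendsto (fun ε => totalVariation (cylinder (n := n) Set.univ ε) u) (𝓝[>] 0) (𝓝 0) := by
  rw [ENNReal.tendsto_nhds_zero]
  intro δ hδ
  obtain ⟨φ, hφ, hlt⟩ : ∃ φ, IsTestField (halfSpace n) φ ∧
      totalVariation (halfSpace n) u ≤ ENNReal.ofReal (∫ x, u x * divergence φ x) + δ := by
    by_contra! hcon
    have h1 : totalVariation (halfSpace n) u ≤ totalVariation (halfSpace n) u - δ :=
      totalVariation_le fun φ hφ => ENNReal.le_sub_of_add_le_right
        (fun hδ' => by simpa [hδ'] using hcon φ hφ) (hcon φ hφ).le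
    have h2 : totalVariation (halfSpace n) u ≠ 0 := fun h => by
      simpa [h] using hcon 0 isTestField_zero
    exact (ENNReal.sub_lt_self hTV.ne h2 hδ.ne').not_ge h1
  obtain ⟨ε, hε, hsub⟩ := hφ.exists_height_lt
  filter_upwards [Ioo_mem_nhdsGT hε] with r hr
  refine (totalVariation_mono (cylinder_mono subset_rfl hr.2.le)).trans ?_
  have h1 := (totalVariation_cylinder_add_le hu hφ hε hsub).trans hlt
  rw [add_comm] at h1
  exact (ENNReal.add_le_add_iff_left ENNReal.ofReal_ne_top).1 h1

/-! ### Vertical cut-offs and averages over boundary layers -/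

/-- A smooth step at scale `ε`: it vanishes for `t ≤ ε / 3` and equals `1` for `t ≥ 2 ε / 3`. -/
noncomputable def cutoff (ε t : ℝ) : ℝ := Real.smoothTransition (3 * t / ε - 1)

section Cutoff

variable {ε t : ℝ}

lemma contDiff_cutoff (ε : ℝ) : ContDiff ℝ 1 (cutoff ε) :=
  Real.smoothTransition.contDiff.comp
    (((contDiff_const.mul contDiff_id).div_const ε).sub contDiff_const)

lemma cutoff_nonneg : 0 ≤ cutoff ε t := Real.smoothTransition.nonneg _

lemma cutoff_le_one : cutoff ε t ≤ 1 := Real.smoothTransition.le_one _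

lemma cutoff_of_le (hε : 0 < ε) (ht : t ≤ ε / 3) : cutoff ε t = 0 :=
  Real.smoothTransition.zero_of_nonpos (by
    rw [sub_nonpos, div_le_one hε]
    linarith)

lemma cutoff_of_ge (hε : 0 < ε) (ht : 2 * ε / 3 ≤ t) : cutoff ε t = 1 :=
  Real.smoothTransition.one_of_one_le (by
    rw [le_sub_iff_add_le, le_div_iff₀ hε]
    linarith)

lemma monotone_cutoff (hε : 0 < ε) : Monotone (cutoff ε) := fun s t hst =>
  Real.smoothTransition.monotone (by gcongr)

lemma hasDerivAt_cutoff (ε t : ℝ) : HasDerivAt (cutoff ε) (deriv (cutoff ε) t) t :=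
  ((contDiff_cutoff ε).differentiable one_ne_zero t).hasDerivAt

lemma continuous_deriv_cutoff (ε : ℝ) : Continuous (deriv (cutoff ε)) :=
  (contDiff_cutoff ε).continuous_deriv_one

lemma deriv_cutoff_nonneg (hε : 0 < ε) : 0 ≤ deriv (cutoff ε) t :=
  (monotone_cutoff hε).deriv_nonneg

lemma deriv_cutoff_of_lt (hε : 0 < ε) (ht : t < ε / 3) : deriv (cutoff ε) t = 0 := by
  have h : cutoff ε =ᶠ[𝓝 t] fun _ => 0 := by
    filter_upwards [Iio_mem_nhds ht] with s hs using cutoff_of_le hε (le_of_lt hs)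
  rw [h.deriv_eq, deriv_const]

lemma deriv_cutoff_of_gt (hε : 0 < ε) (ht : 2 * ε / 3 < t) : deriv (cutoff ε) t = 0 := by
  have h : cutoff ε =ᶠ[𝓝 t] fun _ => 1 := by
    filter_upwards [Ioi_mem_nhds ht] with s hs using cutoff_of_ge hε (le_of_lt hs)
  rw [h.deriv_eq, deriv_const]

lemma exists_bound_deriv_cutoff (hε : 0 < ε) : ∃ C, ∀ t, ‖deriv (cutoff ε) t‖ ≤ C := by
  refine HasCompactSupport.exists_bound_of_continuous ?_ (continuous_deriv_cutoff ε)
  refine HasCompactSupport.intro (isCompact_Icc (a := ε / 3) (b := 2 * ε / 3)) fun t ht => ?_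
  rw [Set.mem_Icc, not_and_or, not_le, not_le] at ht
  exact ht.elim (deriv_cutoff_of_lt hε) (deriv_cutoff_of_gt hε)

end Cutoff

/-- The weighted average of `u` over the layer `0 < t < ε`, as a function on `∂Ω = ℝⁿ`. -/
noncomputable def layerAverage (u : EuclideanSpace ℝ (Fin (n + 1)) → ℝ) (ε : ℝ)
    (y : EuclideanSpace ℝ (Fin n)) : ℝ :=
  ∫ t, u ((split n).symm (y, t)) * deriv (cutoff ε) t

lemma integrable_mul_deriv_cutoff (hu : Integrable u) {ε : ℝ} (hε : 0 < ε)
    {G : EuclideanSpace ℝ (Fin n) → ℝ} (hG : AEStronglyMeasurable G) {C : ℝ}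
    (hC : ∀ᵐ y, ‖G y‖ ≤ C) :
    Integrable fun p : EuclideanSpace ℝ (Fin n) × ℝ =>
      G p.1 * (u ((split n).symm p) * deriv (cutoff ε) p.2) := by
  obtain ⟨D, hD⟩ := exists_bound_deriv_cutoff hε
  have h1 := (integrable_split_iff.2 hu).mul_bdd (c := D)
    ((continuous_deriv_cutoff ε).comp continuous_snd).aestronglyMeasurable
    (Eventually.of_forall fun p : EuclideanSpace ℝ (Fin n) × ℝ => hD p.2)
  exact h1.bdd_mul (c := C) hG.comp_fst (Measure.quasiMeasurePreserving_fst.ae hC)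

lemma integrable_layerAverage (hu : Integrable u) {ε : ℝ} (hε : 0 < ε) :
    Integrable (layerAverage u ε) := by
  have h := integrable_mul_deriv_cutoff hu hε (G := fun _ => 1) aestronglyMeasurable_const
    (C := 1) (by simp)
  simp only [one_mul] at h
  exact h.integral_prod_left

lemma integral_mul_layerAverage (hu : Integrable u) {ε : ℝ} (hε : 0 < ε)
    {G : EuclideanSpace ℝ (Fin n) → ℝ} (hG : AEStronglyMeasurable G) {C : ℝ}
    (hC : ∀ᵐ y, ‖G y‖ ≤ C) :
    ∫ y, G y * layerAverage u ε y =
      ∫ x, u x * (G (split n x).1 * deriv (cutoff ε) (split n x).2) := by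
  rw [integral_split]
  simp only [ContinuousLinearEquiv.apply_symm_apply]
  have h := integrable_mul_deriv_cutoff hu hε hG hC
  have h2 : ∀ p : EuclideanSpace ℝ (Fin n) × ℝ,
      u ((split n).symm p) * (G p.1 * deriv (cutoff ε) p.2) =
      G p.1 * (u ((split n).symm p) * deriv (cutoff ε) p.2) := fun p => by ring
  simp only [h2]
  rw [Measure.volume_eq_prod, integral_prod _ h]
  simp only [integral_const_mul, layerAverage]

lemma hasCompactSupport_of_split {ψ : EuclideanSpace ℝ (Fin (n + 1)) → ℝ}
    {U K : Set (EuclideanSpace ℝ (Fin n))} (hK : IsCompact K) (hKU : K ⊆ U) {a b r : ℝ}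
    (ha : 0 < a) (hb : b < r)
    (h : ∀ x, ψ x ≠ 0 → (split n x).1 ∈ K ∧ (split n x).2 ∈ Set.Icc a b) :
    HasCompactSupport ψ ∧ tsupport ψ ⊆ cylinder U r := by
  have hc : IsCompact (split n ⁻¹' (K ×ˢ Set.Icc a b)) := by
    have := (split n).toHomeomorph.isCompact_preimage.2 (hK.prod (isCompact_Icc (a := a) (b := b)))
    exact this
  have hsub : tsupport ψ ⊆ split n ⁻¹' (K ×ˢ Set.Icc a b) :=
    closure_minimal (fun x hx => h x hx) hc.isClosed
  exact ⟨hc.of_isClosed_subset (isClosed_tsupport _) hsub, fun x hx =>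
    ⟨hKU (hsub hx).1, ha.trans_le (hsub hx).2.1, (hsub hx).2.2.trans_lt hb⟩⟩

/-- Two averages over sublayers of `0 < t < r` differ in `L¹(ℝⁿ)` by at most the total variation in
the layer: the difference is the pairing with a vertical derivative of a function with values
in `[-1, 1]`. -/
lemma integral_abs_layerAverage_sub_le (hu : Integrable u) {r : ℝ}
    (hTV : totalVariation (cylinder Set.univ r) u < ∞) {δ ε : ℝ} (hδ : 0 < δ) (hε : 0 < ε)
    (hδr : δ ≤ r) (hεr : ε ≤ r) :
    ∫ y, |layerAverage u δ y - layerAverage u ε y| ≤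
      (totalVariation (cylinder Set.univ r) u).toReal := by
  rw [← setIntegral_univ]
  have hiδ := integrable_layerAverage hu hδ
  have hiε := integrable_layerAverage hu hε
  refine setIntegral_abs_le_of_forall_test (hiδ.sub hiε) isOpen_univ fun g g1 g2 g3 g4 => ?_
  set ψ : EuclideanSpace ℝ (Fin (n + 1)) → ℝ := fun x =>
    g (split n x).1 * (cutoff δ (split n x).2 - cutoff ε (split n x).2) with hψ
  have hs : ContDiff ℝ 1 (split n) := (split n).contDiff
  have hψ1 : ContDiff ℝ 1 ψ := (g1.comp hs.fst).mul
    (((contDiff_cutoff δ).comp hs.snd).sub ((contDiff_cutoff ε).comp hs.snd))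
  obtain ⟨hψ2, hψ3⟩ := hasCompactSupport_of_split (ψ := ψ) (U := Set.univ) (K := tsupport g)
    (a := min (δ / 3) (ε / 3)) (b := 2 * r / 3) (r := r) g2.isCompact (Set.subset_univ _)
    (by positivity) (by linarith) (fun x hx => by
      refine ⟨by_contra fun hx' => hx ?_, le_of_not_gt fun hx' => hx ?_,
        le_of_not_gt fun hx' => hx ?_⟩
      · simp [hψ, image_eq_zero_of_notMem_tsupport hx']
      · rw [lt_min_iff] at hx'
        simp [hψ, cutoff_of_le hδ hx'.1.le, cutoff_of_le hε hx'.2.le]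
      · have h1 : cutoff δ (split n x).2 = 1 := cutoff_of_ge hδ (by linarith)
        have h2 : cutoff ε (split n x).2 = 1 := cutoff_of_ge hε (by linarith)
        simp [hψ, h1, h2])
  have hψ4 : ∀ x, |ψ x| ≤ 1 := fun x => by
    rw [hψ, abs_mul]
    refine mul_le_one₀ (g4 _) (abs_nonneg _) ?_
    rw [abs_le]
    constructor <;> linarith [cutoff_nonneg (ε := δ) (t := (split n x).2),
      cutoff_nonneg (ε := ε) (t := (split n x).2), cutoff_le_one (ε := δ) (t := (split n x).2),
      cutoff_le_one (ε := ε) (t := (split n x).2)]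
  have hder : ∀ x, fderiv ℝ ψ x (up n) = g (split n x).1 * deriv (cutoff δ) (split n x).2 -
      g (split n x).1 * deriv (cutoff ε) (split n x).2 := by
    intro x
    refine fderiv_up_eq_of_hasDerivAt hψ1 ?_
    simp only [hψ, ContinuousLinearEquiv.apply_symm_apply]
    rw [← mul_sub]
    exact ((hasDerivAt_cutoff _ _).sub (hasDerivAt_cutoff _ _)).const_mul _
  have h := integral_mul_fderiv_up_le hTV hψ1 hψ2 hψ3 one_pos hψ4
  rw [one_mul] at h
  refine le_of_eq_of_le ?_ h
  have hgm : AEStronglyMeasurable g := g1.continuous.aestronglyMeasurable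
  have hgb : ∀ᵐ y, ‖g y‖ ≤ 1 := Eventually.of_forall g4
  have hi : ∀ {ε : ℝ}, 0 < ε → Integrable fun x =>
      u x * (g (split n x).1 * deriv (cutoff ε) (split n x).2) := by
    intro ε hε
    rw [← integrable_split_iff]
    refine (integrable_mul_deriv_cutoff hu hε hgm hgb).congr (Eventually.of_forall fun p => ?_)
    simp only [ContinuousLinearEquiv.apply_symm_apply]
    ring
  simp only [hder, mul_sub, Pi.sub_apply]
  rw [integral_sub (hi hδ) (hi hε), integral_sub (hiδ.bdd_mul hgm hgb) (hiε.bdd_mul hgm hgb),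
    integral_mul_layerAverage hu hδ hgm hgb, integral_mul_layerAverage hu hε hgm hgb]

/-- The boundary value of a function of bounded variation, as the `L¹` limit of its averages over
boundary layers. -/
lemma exists_boundary_value (hu : Integrable u) (hTV : totalVariation (halfSpace n) u < ∞) :
    ∃ τ : EuclideanSpace ℝ (Fin n) → ℝ, Integrable τ ∧ ∀ ε > 0,
      ∫ y, |τ y - layerAverage u ε y| ≤ (totalVariation (cylinder Set.univ ε) u).toReal := by
  have hTVc : ∀ r, totalVariation (cylinder (n := n) Set.univ r) u < ∞ := fun r =>
    (totalVariation_mono (cylinder_subset_halfSpace _ _)).trans_lt hTV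
  set s : ℕ → ℝ := fun k => 1 / ((k : ℝ) + 1) with hs
  have hs0 : ∀ k, 0 < s k := fun k => by positivity
  have hsanti : ∀ {k l}, k ≤ l → s l ≤ s k := fun {k l} h => by
    simp only [hs]
    gcongr
  have hslim : Tendsto s atTop (𝓝[>] 0) := tendsto_nhdsWithin_iff.2
    ⟨tendsto_one_div_add_atTop_nhds_zero_nat, Eventually.of_forall hs0⟩
  have hi : ∀ k, Integrable (layerAverage u (s k)) := fun k => integrable_layerAverage hu (hs0 k)
  have hcau : CauchySeq fun k => (hi k).toL1 := by
    refine cauchySeq_of_le_tendsto_0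
      (fun N => (totalVariation (cylinder (n := n) Set.univ (s N)) u).toReal) ?_ ?_
    · intro k l N hk hl
      rw [L1.dist_eq_integral_dist]
      refine le_of_eq_of_le (integral_congr_ae ?_) (integral_abs_layerAverage_sub_le hu (hTVc _)
        (hs0 k) (hs0 l) (hsanti hk) (hsanti hl))
      filter_upwards [(hi k).coeFn_toL1, (hi l).coeFn_toL1] with y h1 h2
      rw [h1, h2, Real.dist_eq]
    · exact (ENNReal.tendsto_toReal ENNReal.zero_ne_top).comp
        ((tendsto_totalVariation_cylinder hu hTV).comp hslim)
  obtain ⟨τ, hτ⟩ := cauchySeq_tendsto_of_complete hcau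
  have hτi : Integrable τ := L1.integrable_coeFn τ
  refine ⟨τ, hτi, fun ε hε => ?_⟩
  have hd : Tendsto (fun k => ∫ y, |layerAverage u (s k) y - τ y|) atTop (𝓝 0) := by
    have h1 := tendsto_iff_dist_tendsto_zero.1 hτ
    refine h1.congr fun k => ?_
    rw [L1.dist_eq_integral_dist]
    refine integral_congr_ae ?_
    filter_upwards [(hi k).coeFn_toL1] with y h1
    rw [h1, Real.dist_eq]
  have hlim := hd.add_const (totalVariation (cylinder (n := n) Set.univ ε) u).toReal
  rw [zero_add] at hlim
  refine ge_of_tendsto hlim ?_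
  filter_upwards [hslim (Ioo_mem_nhdsGT hε)] with k hk
  have hiε := integrable_layerAverage hu hε
  refine le_trans ?_ (add_le_add_right (integral_abs_layerAverage_sub_le hu (hTVc ε) (hs0 k) hε
    (le_of_lt hk.2) le_rfl) _)
  have hsum : ∫ y, (|layerAverage u (s k) y - τ y| +
      |layerAverage u (s k) y - layerAverage u ε y|) =
      (∫ y, |layerAverage u (s k) y - τ y|) +
      ∫ y, |layerAverage u (s k) y - layerAverage u ε y| :=
    integral_add ((hi k).sub hτi).abs ((hi k).sub hiε).abs
  rw [← hsum]
  refine integral_mono (hτi.sub hiε).abs (((hi k).sub hτi).abs.add ((hi k).sub hiε).abs)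
    fun y => ?_
  beta_reduce
  rw [abs_sub_comm (layerAverage u (s k) y) (τ y)]
  exact abs_sub_le _ _ _

/-! ### Oscillation of a function of bounded variation above a boundary region -/

lemma exists_Icc_of_isCompact_subset_Ioo {S : Set ℝ} (hS : IsCompact S) {r : ℝ} (hr : 0 < r)
    (h : S ⊆ Set.Ioo 0 r) : ∃ a b, 0 < a ∧ b < r ∧ S ⊆ Set.Icc a b := by
  rcases S.eq_empty_or_nonempty with rfl | hne
  · exact ⟨r / 2, r / 2, by positivity, by linarith, Set.empty_subset _⟩
  · exact ⟨sInf S, sSup S, (h (hS.sInf_mem hne)).1, (h (hS.sSup_mem hne)).2,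
      fun x hx => ⟨csInf_le hS.bddBelow hx, le_csSup hS.bddAbove hx⟩⟩

/-- The integral of `g` along the vertical segment of length `r` above `y`. -/
noncomputable def verticalIntegral (g : EuclideanSpace ℝ (Fin (n + 1)) → ℝ) (r : ℝ)
    (y : EuclideanSpace ℝ (Fin n)) : ℝ :=
  ∫ t in (0 : ℝ)..r, g ((split n).symm (y, t))

lemma contDiff_verticalIntegral {g : EuclideanSpace ℝ (Fin (n + 1)) → ℝ} (hg : ContDiff ℝ 1 g)
    (r : ℝ) : ContDiff ℝ 1 (verticalIntegral g r) := by
  have h : verticalIntegral g r = fun y => verticalPrimitive g ((split n).symm (y, r)) := by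
    funext y
    simp [verticalIntegral, verticalPrimitive]
  rw [h]
  exact (contDiff_verticalPrimitive hg).comp
    ((split n).symm.contDiff.comp (contDiff_id.prodMk contDiff_const))

lemma continuous_vertical {g : EuclideanSpace ℝ (Fin (n + 1)) → ℝ} (hg : Continuous g)
    (y : EuclideanSpace ℝ (Fin n)) : Continuous fun t : ℝ => g ((split n).symm (y, t)) :=
  hg.comp ((split n).symm.continuous.comp (by fun_prop))

lemma abs_verticalIntegral_le {g : EuclideanSpace ℝ (Fin (n + 1)) → ℝ} (hb : ∀ x, |g x| ≤ 1)
    {r : ℝ} (hr : 0 ≤ r) (y : EuclideanSpace ℝ (Fin n)) : |verticalIntegral g r y| ≤ r := by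
  have h := intervalIntegral.norm_integral_le_of_norm_le_const (a := 0) (b := r) (C := 1)
    (f := fun t => g ((split n).symm (y, t))) fun t _ => hb _
  rwa [one_mul, sub_zero, abs_of_nonneg hr] at h

lemma integrable_indicator_cylinder_comp {τ : EuclideanSpace ℝ (Fin n) → ℝ} (hτ : Integrable τ)
    (r : ℝ) :
    Integrable ((cylinder (n := n) Set.univ r).indicator fun x => τ (split n x).1) := by
  rw [← integrable_split_iff]
  have h1 : Integrable ((Set.Ioo 0 r).indicator fun _ : ℝ => (1 : ℝ)) :=
    (integrable_indicator_iff measurableSet_Ioo).2 (by simp)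
  refine (hτ.mul_prod h1).congr (Eventually.of_forall fun p => ?_)
  by_cases hp : p.2 ∈ Set.Ioo 0 r
  · have : (split n).symm p ∈ cylinder Set.univ r := by
      rw [mem_cylinder, ContinuousLinearEquiv.apply_symm_apply]
      exact ⟨Set.mem_univ _, hp⟩
    simp [hp, this]
  · have : (split n).symm p ∉ cylinder Set.univ r := fun h => hp (by
      rw [mem_cylinder, ContinuousLinearEquiv.apply_symm_apply] at h
      exact h.2)
    simp [hp, this]

/-- The mass which a test function `g` puts on a vertical line may be moved to height `0`, at the
cost of the total variation. The move is the vertical derivative of the function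
`∫₀ᵗ g - cutoff ε t * ∫₀ʳ g`, which is bounded by `r`. -/
lemma integral_mul_sub_verticalIntegral_le (hu : Integrable u)
    {U : Set (EuclideanSpace ℝ (Fin n))} {r : ℝ} (hr : 0 < r)
    (hTV : totalVariation (cylinder U r) u < ∞)
    {g : EuclideanSpace ℝ (Fin (n + 1)) → ℝ} (g1 : ContDiff ℝ 1 g) (g2 : HasCompactSupport g)
    (g3 : tsupport g ⊆ cylinder U r) (g4 : ∀ x, |g x| ≤ 1) {ε : ℝ} (hε : 0 < ε) (hεr : ε ≤ r) :
    (∫ x, g x * u x) - ∫ y, verticalIntegral g r y * layerAverage u ε y ≤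
      r * (totalVariation (cylinder U r) u).toReal := by
  have hs : ContDiff ℝ 1 (split n) := (split n).contDiff
  set K : Set (EuclideanSpace ℝ (Fin n)) := (fun x => (split n x).1) '' tsupport g with hK
  have hKc : IsCompact K := g2.isCompact.image hs.fst.continuous
  have hKU : K ⊆ U := by
    rintro _ ⟨x, hx, rfl⟩
    exact (g3 hx).1
  obtain ⟨a, b, ha, hb, hab⟩ := exists_Icc_of_isCompact_subset_Ioo
    (g2.isCompact.image hs.snd.continuous) hr (by
      rintro _ ⟨x, hx, rfl⟩
      exact (g3 hx).2)
  have hg0 : ∀ y t, (y ∉ K ∨ t < a ∨ b < t) → g ((split n).symm (y, t)) = 0 := by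
    intro y t h
    by_contra hne
    have hx := subset_tsupport g (Function.mem_support.2 hne)
    have h1 : y ∈ K := ⟨_, hx, by simp⟩
    have h2 : t ∈ Set.Icc a b := hab ⟨_, hx, by simp⟩
    rcases h with h | h | h
    · exact h h1
    · exact h2.1.not_gt h
    · exact h2.2.not_gt h
  have hint : ∀ y c d, IntervalIntegrable (fun t => g ((split n).symm (y, t))) volume c d :=
    fun y c d => (continuous_vertical g1.continuous y).intervalIntegrable _ _
  set ψ : EuclideanSpace ℝ (Fin (n + 1)) → ℝ := fun x =>
    verticalPrimitive g x - verticalIntegral g r (split n x).1 * cutoff ε (split n x).2 with hψ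
  have hψ1 : ContDiff ℝ 1 ψ := (contDiff_verticalPrimitive g1).sub
    (((contDiff_verticalIntegral g1 r).comp hs.fst).mul ((contDiff_cutoff ε).comp hs.snd))
  have hrest : ∀ x, verticalPrimitive g x - verticalIntegral g r (split n x).1 =
      ∫ t in r..(split n x).2, g ((split n).symm ((split n x).1, t)) := fun x =>
    intervalIntegral.integral_interval_sub_left (hint _ _ _) (hint _ _ _)
  have hψs : ∀ x, ψ x ≠ 0 → (split n x).1 ∈ K ∧
      (split n x).2 ∈ Set.Icc (min a (ε / 3)) (max b (2 * ε / 3)) := by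
    intro x hx
    refine ⟨by_contra fun h => hx ?_, le_of_not_gt fun h => hx ?_, le_of_not_gt fun h => hx ?_⟩
    · have h1 : ∀ t, g ((split n).symm ((split n x).1, t)) = 0 := fun t => hg0 _ _ (Or.inl h)
      simp [hψ, verticalPrimitive, verticalIntegral, h1]
    · rw [lt_min_iff] at h
      have h1 : verticalPrimitive g x = 0 := by
        refine intervalIntegral.integral_zero_ae (Eventually.of_forall fun t ht => ?_)
        refine hg0 _ _ (Or.inr (Or.inl ?_))
        rw [Set.mem_uIoc] at ht
        rcases ht with ht | ht
        · exact ht.2.trans_lt h.1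
        · exact ht.2.trans_lt ha
      simp [hψ, h1, cutoff_of_le hε h.2.le]
    · rw [max_lt_iff] at h
      have h1 : verticalPrimitive g x - verticalIntegral g r (split n x).1 = 0 := by
        rw [hrest]
        refine intervalIntegral.integral_zero_ae (Eventually.of_forall fun t ht => ?_)
        refine hg0 _ _ (Or.inr (Or.inr ?_))
        rw [Set.mem_uIoc] at ht
        rcases ht with ht | ht
        · exact hb.trans ht.1
        · exact h.1.trans ht.1
      simp only [hψ, cutoff_of_ge hε h.2.le, mul_one, h1]
  obtain ⟨hψ2, hψ3⟩ := hasCompactSupport_of_split hKc hKU (r := r)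
    (lt_min ha (by positivity : 0 < ε / 3)) (max_lt hb (by linarith : 2 * ε / 3 < r)) hψs
  have hψ4 : ∀ x, |ψ x| ≤ r := by
    intro x
    by_cases hx : ψ x = 0
    · rw [hx, abs_zero]
      exact hr.le
    have hxs := (hψ3 (subset_tsupport _ hx)).2
    have e1 : |verticalPrimitive g x| ≤ (split n x).2 := abs_verticalIntegral_le g4 hxs.1.le _
    have e2 : |verticalPrimitive g x - verticalIntegral g r (split n x).1| ≤
        r - (split n x).2 := by
      rw [hrest]
      have h := intervalIntegral.norm_integral_le_of_norm_le_const (a := r) (b := (split n x).2)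
        (C := 1) (f := fun t => g ((split n).symm ((split n x).1, t))) fun t _ => g4 _
      rwa [one_mul, abs_sub_comm, abs_of_nonneg (sub_nonneg.2 hxs.2.le)] at h
    -- `ψ x` is a convex combination of an integral over `(0, t)` and one over `(t, r)`.
    have e3 : ψ x = (1 - cutoff ε (split n x).2) * verticalPrimitive g x +
        cutoff ε (split n x).2 *
          (verticalPrimitive g x - verticalIntegral g r (split n x).1) := by
      simp only [hψ]
      ring
    have c0 := cutoff_nonneg (ε := ε) (t := (split n x).2)
    have c1 := cutoff_le_one (ε := ε) (t := (split n x).2)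
    have hx1 : 0 < (split n x).2 := hxs.1
    have hx2 : (split n x).2 < r := hxs.2
    rw [e3]
    refine (abs_add_le _ _).trans ?_
    rw [abs_mul, abs_mul, abs_of_nonneg c0, abs_of_nonneg (sub_nonneg.2 c1)]
    calc (1 - cutoff ε (split n x).2) * |verticalPrimitive g x| + cutoff ε (split n x).2 *
          |verticalPrimitive g x - verticalIntegral g r (split n x).1|
        ≤ (1 - cutoff ε (split n x).2) * r + cutoff ε (split n x).2 * r := by
          have := sub_nonneg.2 c1
          gcongr
          · linarith
          · linarith
      _ = r := by ring
  have hder : ∀ x, fderiv ℝ ψ x (up n) =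
      g x - verticalIntegral g r (split n x).1 * deriv (cutoff ε) (split n x).2 := by
    intro x
    refine fderiv_up_eq_of_hasDerivAt hψ1 ?_
    simp only [hψ, ContinuousLinearEquiv.apply_symm_apply, verticalPrimitive]
    refine HasDerivAt.sub ?_ ((hasDerivAt_cutoff _ _).const_mul _)
    have h1 := ((continuous_vertical g1.continuous (split n x).1).integral_hasStrictDerivAt 0
      (split n x).2).hasDerivAt
    simpa using h1
  have h := integral_mul_fderiv_up_le hTV hψ1 hψ2 hψ3 hr hψ4
  refine le_of_eq_of_le ?_ h
  have hGm : AEStronglyMeasurable (verticalIntegral g r) :=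
    (contDiff_verticalIntegral g1 r).continuous.aestronglyMeasurable
  have hGb : ∀ᵐ y, ‖verticalIntegral g r y‖ ≤ r :=
    Eventually.of_forall (abs_verticalIntegral_le g4 hr.le)
  rw [integral_mul_layerAverage hu hε hGm hGb, ← integral_sub]
  · refine integral_congr_ae (Eventually.of_forall fun x => ?_)
    simp only [hder]
    ring
  · exact hu.bdd_mul (c := 1) g1.continuous.aestronglyMeasurable (Eventually.of_forall g4)
  · rw [← integrable_split_iff]
    refine (integrable_mul_deriv_cutoff hu hε hGm hGb).congr (Eventually.of_forall fun p => ?_)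
    simp only [ContinuousLinearEquiv.apply_symm_apply]
    ring

/-- Above an open set `U` of the boundary, the mean distance over `0 < t < r` of `u` to its
boundary values is at most the total variation. -/
lemma integral_abs_sub_boundary_value_le (hu : Integrable u)
    (hTV : totalVariation (halfSpace n) u < ∞) {τ : EuclideanSpace ℝ (Fin n) → ℝ}
    (hτ : Integrable τ)
    (hlim : ∀ ε > 0, ∫ y, |τ y - layerAverage u ε y| ≤
      (totalVariation (cylinder Set.univ ε) u).toReal)
    {U : Set (EuclideanSpace ℝ (Fin n))} (hU : IsOpen U) {r : ℝ} (hr : 0 < r) :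
    ∫ x in cylinder U r, |u x - τ (split n x).1| ≤
      r * (totalVariation (cylinder U r) u).toReal := by
  have hTVc : totalVariation (cylinder U r) u < ∞ :=
    (totalVariation_mono (cylinder_subset_halfSpace _ _)).trans_lt hTV
  have hτi := integrable_indicator_cylinder_comp hτ r
  set τ' := (cylinder (n := n) Set.univ r).indicator fun x => τ (split n x).1 with hτ'
  have heq : ∀ x ∈ cylinder U r, τ' x = τ (split n x).1 := fun x hx =>
    Set.indicator_of_mem (cylinder_mono (Set.subset_univ U) le_rfl hx) _
  have h1 : ∫ x in cylinder U r, |u x - τ (split n x).1| = ∫ x in cylinder U r, |u x - τ' x| :=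
    setIntegral_congr_fun (isOpen_cylinder hU r).measurableSet fun x hx => by
      simp only [heq x hx]
  rw [h1]
  refine setIntegral_abs_le_of_forall_test (hu.sub hτi) (isOpen_cylinder hU r)
    fun g g1 g2 g3 g4 => ?_
  have hgm : AEStronglyMeasurable g := g1.continuous.aestronglyMeasurable
  have hgu : Integrable fun x => g x * u x := hu.bdd_mul hgm (Eventually.of_forall g4)
  have hgτ : Integrable fun x => g x * τ' x := hτi.bdd_mul hgm (Eventually.of_forall g4)
  have hFub : ∫ x, g x * τ' x = ∫ y, verticalIntegral g r y * τ y := by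
    rw [integral_split]
    have hgτ' := integrable_split_iff.2 hgτ
    rw [Measure.volume_eq_prod] at hgτ' ⊢
    rw [integral_prod _ hgτ']
    refine integral_congr_ae (Eventually.of_forall fun y => ?_)
    simp only [verticalIntegral]
    rw [intervalIntegral.integral_eq_integral_of_support_subset, ← integral_mul_const]
    · refine integral_congr_ae (Eventually.of_forall fun t => ?_)
      simp only
      by_cases hx : (split n).symm (y, t) ∈ tsupport g
      · rw [heq _ (g3 hx), ContinuousLinearEquiv.apply_symm_apply]
      · rw [image_eq_zero_of_notMem_tsupport hx, zero_mul, zero_mul]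
    · intro t ht
      have h2 := g3 (subset_tsupport g ht)
      rw [mem_cylinder, ContinuousLinearEquiv.apply_symm_apply] at h2
      exact ⟨h2.2.1, h2.2.2.le⟩
  have hGm : AEStronglyMeasurable (verticalIntegral g r) :=
    (contDiff_verticalIntegral g1 r).continuous.aestronglyMeasurable
  have hGb : ∀ y, ‖verticalIntegral g r y‖ ≤ r := abs_verticalIntegral_le g4 hr.le
  have hmain : ∀ ε ∈ Set.Ioo 0 r, ∫ x, g x * (u x - τ' x) ≤
      r * (totalVariation (cylinder U r) u).toReal +
      r * (totalVariation (cylinder (n := n) Set.univ ε) u).toReal := by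
    intro ε hε
    have hi := integrable_layerAverage hu hε.1
    have h2 := integral_mul_sub_verticalIntegral_le hu hr hTVc g1 g2 g3 g4 hε.1 hε.2.le
    have h3 : (∫ y, verticalIntegral g r y * layerAverage u ε y) -
        ∫ y, verticalIntegral g r y * τ y ≤ r * ∫ y, |τ y - layerAverage u ε y| := by
      rw [← integral_sub (hi.bdd_mul hGm (Eventually.of_forall hGb))
        (hτ.bdd_mul hGm (Eventually.of_forall hGb)), ← integral_const_mul]
      refine integral_mono ((hi.bdd_mul hGm (Eventually.of_forall hGb)).sub
        (hτ.bdd_mul hGm (Eventually.of_forall hGb))) ((hτ.sub hi).abs.const_mul r) fun y => ?_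
      have h4 := mul_le_mul_of_nonneg_right (hGb y) (abs_nonneg (τ y - layerAverage u ε y))
      rw [Real.norm_eq_abs, ← abs_mul] at h4
      calc verticalIntegral g r y * layerAverage u ε y - verticalIntegral g r y * τ y
          = -(verticalIntegral g r y * (τ y - layerAverage u ε y)) := by ring
        _ ≤ _ := (neg_le_abs _).trans h4
    have h5 : ∫ x, g x * (u x - τ' x) = (∫ x, g x * u x) - ∫ x, g x * τ' x := by
      rw [← integral_sub hgu hgτ]
      simp only [mul_sub]
    have h6 := mul_le_mul_of_nonneg_left (hlim ε hε.1) hr.le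
    rw [h5, hFub]
    linarith
  have hl : Tendsto (fun ε => r * (totalVariation (cylinder U r) u).toReal +
      r * (totalVariation (cylinder (n := n) Set.univ ε) u).toReal) (𝓝[>] 0)
      (𝓝 (r * (totalVariation (cylinder U r) u).toReal)) := by
    have := ((ENNReal.tendsto_toReal ENNReal.zero_ne_top).comp
      (tendsto_totalVariation_cylinder hu hTV)).const_mul r
    simpa using this.const_add (r * (totalVariation (cylinder U r) u).toReal)
  refine ge_of_tendsto hl ?_
  filter_upwards [Ioo_mem_nhdsGT hr] with ε hε using hmain ε hε

/-! ### Existence of traces -/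

/-- A maximal estimate of weak type for the total variation above balls of the boundary, by the
Vitali covering lemma. -/
lemma volume_setOf_le_totalVariation_le (hu : Integrable u) {ε : ℝ} {c : ℝ≥0∞} (hc : c ≠ 0)
    (hc' : c ≠ ∞) :
    volume {x : EuclideanSpace ℝ (Fin n) | ∃ r ∈ Set.Ioo 0 ε,
      c * volume (Metric.closedBall x r) ≤ totalVariation (cylinder (Metric.ball x r) r) u} ≤
      ENNReal.ofReal (5 ^ n) * (c⁻¹ * totalVariation (cylinder Set.univ ε) u) := by
  set t := {x : EuclideanSpace ℝ (Fin n) | ∃ r ∈ Set.Ioo 0 ε,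
      c * volume (Metric.closedBall x r) ≤ totalVariation (cylinder (Metric.ball x r) r) u}
    with ht
  have hch : ∀ x : EuclideanSpace ℝ (Fin n), ∃ r : ℝ, x ∈ t → r ∈ Set.Ioo 0 ε ∧
      c * volume (Metric.closedBall x r) ≤ totalVariation (cylinder (Metric.ball x r) r) u := by
    intro x
    by_cases hx : x ∈ t
    · obtain ⟨r, hr, h⟩ := hx
      exact ⟨r, fun _ => ⟨hr, h⟩⟩
    · exact ⟨0, fun h => absurd h hx⟩
  choose r hr using hch
  obtain ⟨s, hst, hdisj, hcov⟩ := Vitali.exists_disjoint_subfamily_covering_enlargement_closedBall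
    t (fun x => x) r ε (fun x hx => (hr x hx).1.2.le) 5 (by norm_num)
  have hrs : ∀ x ∈ s, 0 < r x := fun x hx => (hr x (hst hx)).1.1
  have hcount : s.Countable := by
    refine hdisj.countable_of_nonempty_interior fun x hx => ?_
    exact ⟨x, interior_mono Metric.ball_subset_closedBall (by
      rw [Metric.isOpen_ball.interior_eq]
      exact Metric.mem_ball_self (hrs x hx))⟩
  have hsub : t ⊆ ⋃ x ∈ s, Metric.closedBall x (5 * r x) := by
    intro x hx
    obtain ⟨y, hy, hxy⟩ := hcov x hx
    exact Set.mem_biUnion hy (hxy (Metric.mem_closedBall_self (hr x hx).1.1.le))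
  have hvol : ∀ x ∈ s, volume (Metric.closedBall x (5 * r x)) ≤
      ENNReal.ofReal (5 ^ n) * (c⁻¹ * totalVariation (cylinder (Metric.ball x (r x)) ε) u) := by
    intro x hx
    rw [Measure.addHaar_closedBall_mul _ _ (by norm_num) (hrs x hx).le, finrank_euclideanSpace_fin,
      ← Measure.addHaar_closedBall_center volume x]
    gcongr
    rw [← ENNReal.mul_le_iff_le_inv hc hc']
    exact (hr x (hst hx)).2.trans
      (totalVariation_mono (cylinder_mono subset_rfl (hr x (hst hx)).1.2.le))
  calc volume t ≤ volume (⋃ x ∈ s, Metric.closedBall x (5 * r x)) := measure_mono hsub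
    _ ≤ ∑' x : s, volume (Metric.closedBall (x : EuclideanSpace ℝ (Fin n)) (5 * r x)) :=
      measure_biUnion_le _ hcount _
    _ ≤ ∑' x : s, ENNReal.ofReal (5 ^ n) *
        (c⁻¹ * totalVariation (cylinder (Metric.ball (x : EuclideanSpace ℝ (Fin n)) (r x)) ε) u) :=
      ENNReal.tsum_le_tsum fun x => hvol x x.2
    _ = ENNReal.ofReal (5 ^ n) * (c⁻¹ * ∑' x : s, totalVariation
        (cylinder (Metric.ball (x : EuclideanSpace ℝ (Fin n)) (r x)) ε) u) := by
      rw [ENNReal.tsum_mul_left, ENNReal.tsum_mul_left]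
    _ ≤ _ := by
      gcongr
      rw [ENNReal.tsum_eq_iSup_sum]
      refine iSup_le fun F => ?_
      refine (sum_totalVariation_le hu F ?_).trans (totalVariation_mono
        (Set.iUnion₂_subset fun i _ => cylinder_mono (Set.subset_univ _) le_rfl))
      intro x _ y _ hxy
      have h1 := hdisj x.2 y.2 fun h => hxy (Subtype.ext h)
      refine Set.disjoint_left.2 fun z hz hz' => Set.disjoint_left.1 h1
        (Metric.ball_subset_closedBall hz.1) (Metric.ball_subset_closedBall hz'.1)

/-- At almost every boundary point the total variation has density zero with respect to the
`n`-dimensional measure. -/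
lemma ae_eventually_totalVariation_le (hu : Integrable u)
    (hTV : totalVariation (halfSpace n) u < ∞) :
    ∀ᵐ x : EuclideanSpace ℝ (Fin n), ∀ c : ℝ≥0∞, c ≠ 0 → ∀ᶠ r in 𝓝[>] (0 : ℝ),
      totalVariation (cylinder (Metric.ball x r) r) u ≤ c * volume (Metric.closedBall x r) := by
  -- For a fixed density the exceptional set has measure at most a multiple of the total variation
  -- in the layer `0 < t < ε`, for every `ε`.
  have hnull : ∀ m : ℕ, ∀ᵐ x : EuclideanSpace ℝ (Fin n), ∃ ε > 0, ∀ r ∈ Set.Ioo 0 ε,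
      totalVariation (cylinder (Metric.ball x r) r) u ≤
        ((m : ℝ≥0∞) + 1)⁻¹ * volume (Metric.closedBall x r) := by
    intro m
    have hm : ((m : ℝ≥0∞) + 1)⁻¹ ≠ 0 := by simp
    have hm' : ((m : ℝ≥0∞) + 1)⁻¹ ≠ ∞ := by simp
    have hlim : Tendsto (fun ε => ENNReal.ofReal (5 ^ n) * ((((m : ℝ≥0∞) + 1)⁻¹)⁻¹ *
        totalVariation (cylinder (n := n) Set.univ ε) u)) (𝓝[>] 0) (𝓝 0) := by
      have h1 := ENNReal.Tendsto.const_mul (a := (((m : ℝ≥0∞) + 1)⁻¹)⁻¹)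
        (tendsto_totalVariation_cylinder hu hTV) (Or.inr (by simp))
      have h2 := ENNReal.Tendsto.const_mul (a := ENNReal.ofReal (5 ^ n)) h1
        (Or.inr ENNReal.ofReal_ne_top)
      simpa using h2
    rw [ae_iff, ← nonpos_iff_eq_zero]
    refine ge_of_tendsto hlim ?_
    filter_upwards [self_mem_nhdsWithin] with ε hε
    refine (measure_mono fun x hx => ?_).trans (volume_setOf_le_totalVariation_le hu hm hm')
    simp only [Set.mem_ofPred_eq, not_exists, not_and] at hx
    have h1 := hx ε hε
    push Not at h1
    obtain ⟨r, hr, h2⟩ := h1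
    exact ⟨r, hr, h2.le⟩
  filter_upwards [ae_all_iff.2 hnull] with x hx c hc
  obtain ⟨m, hm⟩ := ENNReal.exists_inv_nat_lt hc
  obtain ⟨ε, hε, h⟩ := hx m
  filter_upwards [Ioo_mem_nhdsGT hε] with r hr
  refine (h r hr).trans ?_
  gcongr
  exact (ENNReal.inv_le_inv.2 le_self_add).trans hm.le

lemma measurePreserving_split :
    MeasurePreserving (split n) volume (volume : Measure (EuclideanSpace ℝ (Fin n) × ℝ)) := by
  refine ⟨(split n).continuous.measurable, Measure.ext fun s hs => ?_⟩
  rw [Measure.map_apply (split n).continuous.measurable hs, volume_preimage_split]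

lemma volume_cylinder (U : Set (EuclideanSpace ℝ (Fin n))) (r : ℝ) :
    volume (cylinder U r) = volume U * ENNReal.ofReal r := by
  rw [cylinder, volume_preimage_split, Measure.volume_eq_prod, Measure.prod_prod, Real.volume_Ioo,
    sub_zero]

lemma setIntegral_cylinder_comp (h : EuclideanSpace ℝ (Fin n) → ℝ)
    (U : Set (EuclideanSpace ℝ (Fin n))) {r : ℝ} (hr : 0 ≤ r) :
    ∫ x in cylinder U r, h (split n x).1 = r * ∫ y in U, h y := by
  have h1 := measurePreserving_split.setIntegral_preimage_emb
    (split n).toHomeomorph.measurableEmbedding (fun p => h p.1 * 1) (U ×ˢ Set.Ioo 0 r)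
  simp only [mul_one] at h1
  rw [cylinder, h1]
  have h2 := setIntegral_prod_mul (μ := (volume : Measure (EuclideanSpace ℝ (Fin n))))
    (ν := (volume : Measure ℝ)) h (fun _ => (1 : ℝ)) U (Set.Ioo 0 r)
  simp only [mul_one] at h2
  rw [Measure.volume_eq_prod, h2]
  simp [hr, mul_comm]

lemma ball_inter_halfSpace_subset_cylinder (x : EuclideanSpace ℝ (Fin n)) (r : ℝ) :
    Metric.ball (boundaryPoint x) r ∩ halfSpace n ⊆ cylinder (Metric.ball x r) r := by
  rintro z ⟨hz, hz0⟩
  have h1 := norm_sq_eq_split (z - boundaryPoint x)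
  rw [boundaryPoint_eq, map_sub, ContinuousLinearEquiv.apply_symm_apply, Prod.fst_sub,
    Prod.snd_sub, sub_zero, ← boundaryPoint_eq] at h1
  rw [mem_ball_iff_norm] at hz
  have hz0' : 0 < (split n z).2 := hz0
  have hr : 0 < r := (norm_nonneg _).trans_lt hz
  refine mem_cylinder.2 ⟨mem_ball_iff_norm.2 ?_, hz0', ?_⟩
  · exact (abs_le_of_sq_le_sq' (by nlinarith [sq_nonneg (split n z).2]) (norm_nonneg _)).2.trans_lt
      hz
  · exact (abs_le_of_sq_le_sq' (by nlinarith [sq_nonneg ‖(split n z).1 - x‖])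
      (norm_nonneg _)).2.trans_lt hz

lemma cylinder_subset_ball_inter_halfSpace (x : EuclideanSpace ℝ (Fin n)) (r : ℝ) :
    cylinder (Metric.closedBall x (r / 2)) (r / 2) ⊆
      Metric.ball (boundaryPoint x) r ∩ halfSpace n := by
  intro z hz
  obtain ⟨h1, h2, h3⟩ := mem_cylinder.1 hz
  refine ⟨?_, h2⟩
  have h4 := norm_sq_eq_split (z - boundaryPoint x)
  rw [boundaryPoint_eq, map_sub, ContinuousLinearEquiv.apply_symm_apply, Prod.fst_sub,
    Prod.snd_sub, sub_zero, ← boundaryPoint_eq] at h4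
  rw [mem_closedBall_iff_norm] at h1
  rw [mem_ball_iff_norm]
  have h5 := norm_nonneg ((split n z).1 - x)
  exact lt_of_pow_lt_pow_left₀ 2 (by linarith) (by nlinarith)

lemma volume_halfBall_pos (x : EuclideanSpace ℝ (Fin n)) {r : ℝ} (hr : 0 < r) :
    0 < volume.real (Metric.ball (boundaryPoint x) r ∩ halfSpace n) := by
  have hfin : volume (Metric.ball (boundaryPoint x) r ∩ halfSpace n) ≠ ∞ :=
    ((measure_mono Set.inter_subset_left).trans_lt measure_ball_lt_top).ne
  refine ENNReal.toReal_pos (ne_of_gt ?_) hfin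
  refine lt_of_lt_of_le ?_ (measure_mono (cylinder_subset_ball_inter_halfSpace x r))
  rw [volume_cylinder]
  exact ENNReal.mul_pos (Metric.measure_closedBall_pos volume x (by positivity)).ne'
    (by simpa using hr)

/-- The half-ball is comparable to the cylinder with the same radius. -/
lemma mul_volume_closedBall_le (x : EuclideanSpace ℝ (Fin n)) {r : ℝ} (hr : 0 < r) :
    r * volume.real (Metric.closedBall x r) ≤
      2 ^ (n + 1) * volume.real (Metric.ball (boundaryPoint x) r ∩ halfSpace n) := by
  have h1 : volume.real (cylinder (Metric.closedBall x (r / 2)) (r / 2)) ≤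
      volume.real (Metric.ball (boundaryPoint x) r ∩ halfSpace n) :=
    measureReal_mono (cylinder_subset_ball_inter_halfSpace x r)
      ((measure_mono Set.inter_subset_left).trans_lt measure_ball_lt_top).ne
  have h2 : volume.real (cylinder (Metric.closedBall x (r / 2)) (r / 2)) =
      volume.real (Metric.closedBall x (r / 2)) * (r / 2) := by
    rw [measureReal_def, volume_cylinder, ENNReal.toReal_mul, ENNReal.toReal_ofReal (by positivity),
      measureReal_def]
  have h3 : volume.real (Metric.closedBall x r) =
      2 ^ n * volume.real (Metric.closedBall x (r / 2)) := by
    have h := Measure.addHaar_closedBall_mul (volume : Measure (EuclideanSpace ℝ (Fin n))) x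
      (r := 2) (s := r / 2) (by norm_num) (by positivity)
    rw [mul_div_cancel₀ r (two_ne_zero), finrank_euclideanSpace_fin,
      ← Measure.addHaar_closedBall_center volume x] at h
    rw [measureReal_def, h, ENNReal.toReal_mul, ENNReal.toReal_ofReal (by positivity),
      measureReal_def]
  rw [h3]
  rw [h2] at h1
  calc r * (2 ^ n * volume.real (Metric.closedBall x (r / 2)))
      = 2 ^ (n + 1) * (volume.real (Metric.closedBall x (r / 2)) * (r / 2)) := by ring
    _ ≤ _ := by gcongr

lemma HasTraceAt.unique (hu : Integrable u) {x : EuclideanSpace ℝ (Fin n)} {a b : ℝ}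
    (ha : HasTraceAt u x a) (hb : HasTraceAt u x b) : a = b := by
  have h1 := ha.add hb
  rw [add_zero] at h1
  have h2 : |a - b| ≤ 0 := by
    refine ge_of_tendsto h1 ?_
    filter_upwards [self_mem_nhdsWithin] with r hr
    set S := Metric.ball (boundaryPoint x) r ∩ halfSpace n with hS
    have hfin : volume S ≠ ∞ :=
      ((measure_mono Set.inter_subset_left).trans_lt measure_ball_lt_top).ne
    have hpos : 0 < volume.real S := volume_halfBall_pos x hr
    have hi : ∀ c : ℝ, IntegrableOn (fun y => |u y - c|) S := fun c =>
      (hu.integrableOn.sub (integrableOn_const hfin)).abs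
    rw [setAverage_eq, setAverage_eq, ← smul_add, ← integral_add (hi a) (hi b), smul_eq_mul,
      le_inv_mul_iff₀ hpos]
    have h3 : ∫ _ in S, |a - b| = volume.real S * |a - b| := by
      rw [setIntegral_const, smul_eq_mul]
    rw [← h3]
    refine integral_mono (integrableOn_const hfin) ((hi a).add (hi b)) fun y => ?_
    beta_reduce
    rw [abs_sub_comm (u y) a]
    exact abs_sub_le _ _ _
  exact sub_eq_zero.1 (abs_nonpos_iff.1 h2)

lemma HasTraceAt.trace_eq (hu : Integrable u) {x : EuclideanSpace ℝ (Fin n)} {a : ℝ}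
    (ha : HasTraceAt u x a) : trace u x = a := by
  have h : ∃ a, HasTraceAt u x a := ⟨a, ha⟩
  rw [trace, dif_pos h]
  exact h.choose_spec.unique hu ha

lemma hasTraceAt_indicator {x : EuclideanSpace ℝ (Fin n)} {a : ℝ} :
    HasTraceAt ((halfSpace n).indicator u) x a ↔ HasTraceAt u x a := by
  have h : ∀ r : ℝ, ⨍ y in Metric.ball (boundaryPoint x) r ∩ halfSpace n,
      |(halfSpace n).indicator u y - a| =
      ⨍ y in Metric.ball (boundaryPoint x) r ∩ halfSpace n, |u y - a| := fun r =>
    setAverage_congr_fun (Metric.isOpen_ball.inter isOpen_halfSpace).measurableSet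
      (Eventually.of_forall fun y hy => by simp only [Set.indicator_of_mem hy.2])
  simp only [HasTraceAt, h]

lemma trace_indicator (x : EuclideanSpace ℝ (Fin n)) :
    trace ((halfSpace n).indicator u) x = trace u x := by
  have h : HasTraceAt ((halfSpace n).indicator u) x = HasTraceAt u x :=
    funext fun _ => propext hasTraceAt_indicator
  unfold trace
  rw [h]

/-- The `L¹` limit of the averages over boundary layers is the trace almost everywhere: at a
Lebesgue point at which the total variation has density zero. -/
lemma ae_hasTraceAt (hu : Integrable u) (hTV : totalVariation (halfSpace n) u < ∞)
    {τ : EuclideanSpace ℝ (Fin n) → ℝ} (hτ : Integrable τ)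
    (hlim : ∀ ε > 0, ∫ y, |τ y - layerAverage u ε y| ≤
      (totalVariation (cylinder Set.univ ε) u).toReal) :
    ∀ᵐ x, HasTraceAt u x (τ x) := by
  filter_upwards [ae_eventually_totalVariation_le hu hTV,
    (Besicovitch.vitaliFamily
      (volume : Measure (EuclideanSpace ℝ (Fin n)))).ae_tendsto_average_norm_sub
      hτ.locallyIntegrable] with x hx hxτ
  have hxτ' := hxτ.comp (Besicovitch.tendsto_filterAt volume x)
  rw [HasTraceAt, Metric.tendsto_nhds]
  intro δ hδ
  -- Each of the two error terms below is at most `c * r * |B|`, and `r * |B| ≤ 2 ^ (n + 1) * |S|`.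
  set c : ℝ := δ / (2 ^ (n + 1) * 4) with hc
  have hc0 : 0 < c := by positivity
  filter_upwards [self_mem_nhdsWithin, hx (ENNReal.ofReal c) (by simpa using hc0),
    (Metric.tendsto_nhds.1 hxτ') c hc0] with r hr0 h1 h2
  have hr : 0 < r := hr0
  set B := Metric.closedBall x r with hB
  set S := Metric.ball (boundaryPoint x) r ∩ halfSpace n with hS
  set Z := cylinder (Metric.ball x r) r with hZ
  have hVfin : volume B ≠ ∞ := measure_closedBall_lt_top.ne
  have hZfin : volume Z ≠ ∞ := by
    rw [hZ, volume_cylinder]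
    exact ENNReal.mul_ne_top measure_ball_lt_top.ne ENNReal.ofReal_ne_top
  have hV : 0 < volume.real B :=
    ENNReal.toReal_pos (Metric.measure_closedBall_pos volume x hr).ne' hVfin
  have hSpos : 0 < volume.real S := volume_halfBall_pos x hr
  have h1' : (totalVariation Z u).toReal ≤ c * volume.real B := by
    have := ENNReal.toReal_mono (ENNReal.mul_ne_top ENNReal.ofReal_ne_top hVfin) h1
    rwa [ENNReal.toReal_mul, ENNReal.toReal_ofReal hc0.le] at this
  have h2' : ∫ y in B, |τ y - τ x| ≤ c * volume.real B := by
    have h3 := (le_abs_self _).trans_lt ((Real.dist_eq _ _).symm.trans_lt h2)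
    simp only [Function.comp_apply, sub_zero, setAverage_eq, smul_eq_mul] at h3
    rw [inv_mul_lt_iff₀ hV, mul_comm] at h3
    exact h3.le
  have hτZ : IntegrableOn (fun z => τ (split n z).1) Z := by
    have := integrable_indicator_cylinder_comp hτ r
    rw [integrable_indicator_iff (isOpen_cylinder isOpen_univ r).measurableSet] at this
    exact this.mono_set (cylinder_mono (Set.subset_univ _) le_rfl)
  have hi1 : IntegrableOn (fun z => |u z - τ (split n z).1|) Z := (hu.integrableOn.sub hτZ).abs
  have hi2 : IntegrableOn (fun z => |τ (split n z).1 - τ x|) Z :=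
    (hτZ.sub (integrableOn_const hZfin)).abs
  have hi3 : IntegrableOn (fun z => |u z - τ x|) Z :=
    (hu.integrableOn.sub (integrableOn_const hZfin)).abs
  have h4 : ∫ z in S, |u z - τ x| ≤ r * (c * volume.real B) + r * (c * volume.real B) := by
    calc ∫ z in S, |u z - τ x| ≤ ∫ z in Z, |u z - τ x| :=
          setIntegral_mono_set hi3 (Eventually.of_forall fun _ => abs_nonneg _)
            (ball_inter_halfSpace_subset_cylinder x r).eventuallyLE
      _ ≤ ∫ z in Z, (|u z - τ (split n z).1| + |τ (split n z).1 - τ x|) :=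
          integral_mono hi3 (hi1.add hi2) fun z => abs_sub_le _ _ _
      _ = (∫ z in Z, |u z - τ (split n z).1|) + ∫ z in Z, |τ (split n z).1 - τ x| :=
          integral_add hi1 hi2
      _ ≤ r * (totalVariation Z u).toReal + r * ∫ y in B, |τ y - τ x| := by
          refine add_le_add
            (integral_abs_sub_boundary_value_le hu hTV hτ hlim Metric.isOpen_ball hr) ?_
          rw [hZ, setIntegral_cylinder_comp (fun y => |τ y - τ x|) _ hr.le]
          refine mul_le_mul_of_nonneg_left ?_ hr.le
          exact setIntegral_mono_set (hτ.integrableOn.sub (integrableOn_const hVfin)).abs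
            (Eventually.of_forall fun _ => abs_nonneg _)
            Metric.ball_subset_closedBall.eventuallyLE
      _ ≤ _ := by gcongr
  have h5 := mul_volume_closedBall_le x hr
  rw [Real.dist_eq, sub_zero, setAverage_eq, smul_eq_mul, abs_of_nonneg (mul_nonneg
    (inv_nonneg.2 measureReal_nonneg) (integral_nonneg fun _ => abs_nonneg _)),
    inv_mul_lt_iff₀ hSpos]
  refine h4.trans_lt ?_
  calc r * (c * volume.real B) + r * (c * volume.real B)
      = 2 * c * (r * volume.real B) := by ring
    _ ≤ 2 * c * (2 ^ (n + 1) * volume.real S) := by gcongr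
    _ = volume.real S * (δ / 2) := by
      rw [hc]
      field_simp
      ring
    _ < volume.real S * δ := by gcongr; linarith

/-! ### Lower semicontinuity for `|β| ≤ 1` -/

namespace BV

/-- A function in `BV(Ω)`, extended by zero outside `Ω`. -/
noncomputable def zeroExtension (u : BV n) : EuclideanSpace ℝ (Fin (n + 1)) → ℝ :=
  (halfSpace n).indicator u.toFun

lemma integrable_zeroExtension (u : BV n) : Integrable u.zeroExtension :=
  (integrable_indicator_iff isOpen_halfSpace.measurableSet).2 u.isBV.integrableOn

lemma totalVariation_zeroExtension (u : BV n) :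
    totalVariation (halfSpace n) u.zeroExtension = totalVariation (halfSpace n) u.toFun :=
  totalVariation_indicator isOpen_halfSpace.measurableSet subset_rfl

lemma totalVariation_zeroExtension_lt_top (u : BV n) :
    totalVariation (halfSpace n) u.zeroExtension < ∞ :=
  u.totalVariation_zeroExtension.trans_lt u.isBV.totalVariation_lt_top

/-- The trace is integrable, and it is approximated in `L¹(ℝⁿ)` by the averages over boundary
layers, with an error of at most the total variation in the layer. -/
lemma integrable_trace_and_integral_abs_sub_le (u : BV n) :
    Integrable (trace u.toFun) ∧ ∀ ε > 0,
      ∫ y, |trace u.toFun y - layerAverage u.zeroExtension ε y| ≤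
        (totalVariation (cylinder Set.univ ε) u.zeroExtension).toReal := by
  obtain ⟨τ, hτ, hlim⟩ := exists_boundary_value u.integrable_zeroExtension
    u.totalVariation_zeroExtension_lt_top
  have hae : τ =ᵐ[volume] trace u.toFun := by
    filter_upwards [ae_hasTraceAt u.integrable_zeroExtension
      u.totalVariation_zeroExtension_lt_top hτ hlim] with y hy
    rw [← hy.trace_eq u.integrable_zeroExtension, zeroExtension, trace_indicator]
  refine ⟨hτ.congr hae, fun ε hε => le_of_eq_of_le (integral_congr_ae ?_) (hlim ε hε)⟩
  filter_upwards [hae] with y hy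
  rw [hy]

end BV

lemma continuous_integral_mul_bounded {α : Type*} [MeasurableSpace α] {μ : Measure α} {m : α → ℝ}
    (hm : AEStronglyMeasurable m μ) {C : ℝ} (hC : ∀ᵐ x ∂μ, ‖m x‖ ≤ C) :
    Continuous fun f : Lp ℝ 1 μ => ∫ x, f x * m x ∂μ := by
  refine (LipschitzWith.of_dist_le_mul (K := C.toNNReal) fun f g => ?_).continuous
  have hf := L1.integrable_coeFn f
  have hg := L1.integrable_coeFn g
  rw [Real.dist_eq, L1.dist_eq_integral_dist, ← integral_sub (hf.mul_bdd hm hC)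
    (hg.mul_bdd hm hC), ← integral_const_mul]
  refine (abs_integral_le_integral_abs).trans (integral_mono_ae
    ((hf.mul_bdd hm hC).sub (hg.mul_bdd hm hC)).abs ?_ ?_)
  · simp only [Real.dist_eq]
    exact (hf.sub hg).abs.const_mul _
  · filter_upwards [hC] with x hx
    rw [← sub_mul, abs_mul, mul_comm, Real.dist_eq]
    exact mul_le_mul_of_nonneg_right (hx.trans (Real.le_coe_toNNReal C)) (abs_nonneg _)

lemma continuous_integral_zeroExtension_mul {m : EuclideanSpace ℝ (Fin (n + 1)) → ℝ}
    (hm : AEStronglyMeasurable m) {C : ℝ} (hC : ∀ᵐ x, ‖m x‖ ≤ C) :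
    Continuous fun v : BV n => ∫ x, v.zeroExtension x * m x := by
  have h1 := (continuous_integral_mul_bounded (μ := volume.restrict (halfSpace n)) hm.restrict
    (ae_restrict_of_ae hC)).comp (continuous_induced_dom : Continuous (BV.toL1 (n := n)))
  refine h1.congr fun v => ?_
  have h2 : ∀ x, v.zeroExtension x * m x = (halfSpace n).indicator (fun x => v.toFun x * m x) x :=
    fun x => by
      by_cases hx : x ∈ halfSpace n <;> simp [BV.zeroExtension, hx]
  simp only [h2, Function.comp_apply]
  rw [integral_indicator isOpen_halfSpace.measurableSet]
  refine integral_congr_ae ?_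
  filter_upwards [Integrable.coeFn_toL1 v.isBV.integrableOn] with x hx
  rw [BV.toL1, hx]

/-- If `|β| ≤ 1`, the capillary functional of `u` is the supremum of the `L¹`-continuous functionals
`∫ u div φ - ∫ β (average of u over 0 < t < ε)` with `φ` supported above height `ε`. -/
lemma lowerSemicontinuous_levelSetCapillary {β : EuclideanSpace ℝ (Fin n) → ℝ}
    (hβm : AEStronglyMeasurable β) (hβ : ∀ᵐ y, ‖β y‖ ≤ 1) :
    LowerSemicontinuous (levelSetCapillary β) := by
  have hβi : ∀ {f : EuclideanSpace ℝ (Fin n) → ℝ}, Integrable f →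
      Integrable fun y => β y * f y := fun hf => hf.bdd_mul hβm hβ
  have habs : ∀ {f : EuclideanSpace ℝ (Fin n) → ℝ}, Integrable f →
      |∫ y, β y * f y| ≤ ∫ y, |f y| := fun {f} hf => by
    refine abs_integral_le_integral_abs.trans (integral_mono_ae (hβi hf).abs hf.abs ?_)
    filter_upwards [hβ] with y hy
    rw [abs_mul]
    exact mul_le_of_le_one_left (abs_nonneg _) hy
  have hsub : ∀ (v : BV n) {ε : ℝ}, 0 < ε →
      |(∫ y, β y * trace v.toFun y) - ∫ y, β y * layerAverage v.zeroExtension ε y| ≤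
        (totalVariation (cylinder Set.univ ε) v.zeroExtension).toReal := by
    intro v ε hε
    obtain ⟨h1, h2⟩ := v.integrable_trace_and_integral_abs_sub_le
    have h3 := integrable_layerAverage v.integrable_zeroExtension hε
    rw [← integral_sub (hβi h1) (hβi h3)]
    simp only [← mul_sub]
    exact (habs (h1.sub h3)).trans (h2 ε hε)
  intro u c hc
  set L := ∫ y, β y * trace u.toFun y with hL
  have hc' : c + L < (totalVariation (halfSpace n) u.zeroExtension).toReal := by
    rw [u.totalVariation_zeroExtension]
    exact lt_sub_iff_add_lt.1 hc
  obtain ⟨φ, hφ, hφlt⟩ : ∃ φ, IsTestField (halfSpace n) φ ∧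
      c + L < ∫ x, u.zeroExtension x * divergence φ x := by
    by_contra! hcon
    have h0 : 0 ≤ c + L := by
      have := hcon 0 isTestField_zero
      have hz : ∀ x : EuclideanSpace ℝ (Fin (n + 1)),
          divergence (0 : EuclideanSpace ℝ (Fin (n + 1)) → _) x = 0 := fun x =>
        divergence_eq_zero_of_notMem (by simp [tsupport])
      simpa [hz] using this
    have h1 : totalVariation (halfSpace n) u.zeroExtension ≤ ENNReal.ofReal (c + L) :=
      totalVariation_le fun φ hφ => ENNReal.ofReal_le_ofReal (hcon φ hφ)
    exact hc'.not_ge (ENNReal.toReal_le_of_le_ofReal h0 h1)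
  obtain ⟨ε₀, hε₀, hφε⟩ := hφ.exists_height_lt
  have hlim : Tendsto (fun ε => (totalVariation (cylinder (n := n) Set.univ ε)
      u.zeroExtension).toReal) (𝓝[>] 0) (𝓝 0) :=
    (ENNReal.tendsto_toReal ENNReal.zero_ne_top).comp (tendsto_totalVariation_cylinder
      u.integrable_zeroExtension u.totalVariation_zeroExtension_lt_top)
  obtain ⟨ε, hεlt, hε⟩ := ((hlim.eventually (gt_mem_nhds (sub_pos.2 hφlt))).and
    (Ioo_mem_nhdsGT hε₀)).exists
  have hφε' : tsupport φ ⊆ {x | ε < (split n x).2} := fun x hx => hε.2.trans (hφε hx)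
  set m : EuclideanSpace ℝ (Fin (n + 1)) → ℝ := fun x =>
    divergence φ x - β (split n x).1 * deriv (cutoff ε) (split n x).2 with hm
  obtain ⟨D, hD⟩ := exists_bound_divergence hφ.contDiff hφ.hasCompactSupport
  obtain ⟨D', hD'⟩ := exists_bound_deriv_cutoff hε.1
  have hqmp : Measure.QuasiMeasurePreserving
      (fun x : EuclideanSpace ℝ (Fin (n + 1)) => (split n x).1) volume volume :=
    Measure.quasiMeasurePreserving_fst.comp measurePreserving_split.quasiMeasurePreserving
  have hβP := hqmp.ae hβ
  have hm1 : AEStronglyMeasurable m := by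
    refine (continuous_divergence hφ.contDiff).aestronglyMeasurable.sub ?_
    refine (hβm.comp_quasiMeasurePreserving hqmp).mul ?_
    exact ((continuous_deriv_cutoff ε).comp
      (continuous_snd.comp (split n).continuous)).aestronglyMeasurable
  have hm2 : ∀ᵐ x, ‖m x‖ ≤ D + D' := by
    filter_upwards [hβP] with x hx
    refine (norm_sub_le _ _).trans (add_le_add (hD x) ?_)
    rw [norm_mul]
    exact (mul_le_of_le_one_left (norm_nonneg _) hx).trans (hD' _)
  have hF := continuous_integral_zeroExtension_mul hm1 hm2
  have hFeq : ∀ v : BV n, ∫ x, v.zeroExtension x * m x =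
      (∫ x, v.zeroExtension x * divergence φ x) -
        ∫ y, β y * layerAverage v.zeroExtension ε y := by
    intro v
    rw [integral_mul_layerAverage v.integrable_zeroExtension hε.1 hβm hβ, ← integral_sub
      (integrable_mul_divergence v.integrable_zeroExtension hφ.contDiff hφ.hasCompactSupport)]
    · simp only [hm, mul_sub]
    · rw [← integrable_split_iff]
      refine (integrable_mul_deriv_cutoff v.integrable_zeroExtension hε.1 hβm hβ).congr
        (Eventually.of_forall fun p => ?_)
      simp only [ContinuousLinearEquiv.apply_symm_apply]
      ring
  have hFle : ∀ v : BV n, ∫ x, v.zeroExtension x * m x ≤ levelSetCapillary β v := by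
    intro v
    have hfin := v.totalVariation_zeroExtension_lt_top
    have h1 := totalVariation_cylinder_add_le v.integrable_zeroExtension hφ hε.1 hφε'
    have h2 := ENNReal.toReal_mono hfin.ne h1
    rw [ENNReal.toReal_add ((totalVariation_mono (cylinder_subset_halfSpace _ _)).trans_lt hfin).ne
      ENNReal.ofReal_ne_top, v.totalVariation_zeroExtension] at h2
    have h4 : ∫ x, v.zeroExtension x * divergence φ x ≤
        (ENNReal.ofReal (∫ x, v.zeroExtension x * divergence φ x)).toReal := by
      rw [ENNReal.toReal_ofReal']
      exact le_max_left _ _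
    have h5 := (le_abs_self _).trans (hsub v hε.1)
    rw [hFeq, levelSetCapillary]
    linarith
  have hu : c < ∫ x, u.zeroExtension x * m x := by
    rw [hFeq]
    have h5 := (neg_le_abs _).trans (hsub u hε.1)
    linarith
  filter_upwards [hF.continuousAt.eventually (lt_mem_nhds hu)] with v hv
  exact hv.trans_le (hFle v)

/-- The functional on sets is the level-set functional on characteristic functions. -/
lemma lowerSemicontinuous_capillary_of_levelSetCapillary {β : EuclideanSpace ℝ (Fin n) → ℝ}
    (h : LowerSemicontinuous (levelSetCapillary β)) : LowerSemicontinuous (capillary β) := by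
  have hchar : Continuous (BVSet.char (n := n)) := continuous_induced_dom
  have heq : ∀ E : BVSet n, capillary β E = levelSetCapillary β E.char := fun _ => rfl
  intro E c hc
  rw [heq] at hc
  filter_upwards [(hchar.tendsto E).eventually (h E.char c hc)] with F hF
  rwa [heq]

/-! ### Slabs over cubes -/

/-- The closed cube of centre `x` and side `2 r` in `ℝⁿ`. -/
def cube (x : Fin n → ℝ) (r : ℝ) : Set (EuclideanSpace ℝ (Fin n)) :=
  WithLp.ofLp ⁻¹' Metric.closedBall x r

/-- The slab `Q × (s, t]`. It is half-open so that the slabs `Q × (s, 1 + s]` converge to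
`Q × (0, 1]` at every point as `s → 0+`. -/
def slab (Q : Set (EuclideanSpace ℝ (Fin n))) (s t : ℝ) : Set (EuclideanSpace ℝ (Fin (n + 1))) :=
  split n ⁻¹' (Q ×ˢ Set.Ioc s t)

lemma mem_slab {Q : Set (EuclideanSpace ℝ (Fin n))} {s t : ℝ}
    {x : EuclideanSpace ℝ (Fin (n + 1))} :
    x ∈ slab Q s t ↔ (split n x).1 ∈ Q ∧ s < (split n x).2 ∧ (split n x).2 ≤ t := Iff.rfl

lemma slab_subset_halfSpace {Q : Set (EuclideanSpace ℝ (Fin n))} {s t : ℝ} (hs : 0 ≤ s) :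
    slab Q s t ⊆ halfSpace n := fun _ hx => hs.trans_lt hx.2.1

lemma measurableSet_slab {Q : Set (EuclideanSpace ℝ (Fin n))} (hQ : MeasurableSet Q) (s t : ℝ) :
    MeasurableSet (slab Q s t) :=
  (hQ.prod measurableSet_Ioc).preimage (split n).continuous.measurable

lemma volume_slab (Q : Set (EuclideanSpace ℝ (Fin n))) (s t : ℝ) :
    volume (slab Q s t) = volume Q * ENNReal.ofReal (t - s) := by
  rw [slab, volume_preimage_split, Measure.volume_eq_prod, Measure.prod_prod, Real.volume_Ioc]

section Cube

variable (x : Fin n → ℝ) {r : ℝ}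

lemma isClosed_cube : IsClosed (cube x r) :=
  Metric.isClosed_closedBall.preimage (PiLp.continuous_ofLp 2 _)

lemma volume_cube : volume (cube x r) = volume (Metric.closedBall x r) :=
  (PiLp.volume_preserving_ofLp (Fin n)).measure_preimage
    Metric.isClosed_closedBall.measurableSet.nullMeasurableSet

lemma volume_cube_ne_top : volume (cube x r) ≠ ∞ := by
  rw [volume_cube]
  exact measure_closedBall_lt_top.ne

lemma volume_real_cube (hr : 0 ≤ r) : volume.real (cube x r) = (2 * r) ^ n := by
  rw [measureReal_def, volume_cube, Real.volume_pi_closedBall x hr, ENNReal.toReal_ofReal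
    (by positivity), Fintype.card_fin]

lemma volume_frontier_cube : volume (frontier (cube x r)) = 0 := by
  refine Convex.addHaar_frontier volume ?_
  exact (convex_closedBall x r).linear_preimage
    (EuclideanSpace.equiv (Fin n) ℝ).toLinearEquiv.toLinearMap

lemma mem_cube (hr : 0 ≤ r) {y : EuclideanSpace ℝ (Fin n)} :
    y ∈ cube x r ↔ ∀ i, x i - r ≤ y i ∧ y i ≤ x i + r := by
  rw [cube, Set.mem_preimage, Metric.mem_closedBall, dist_pi_le_iff hr]
  refine forall_congr' fun i => ?_
  rw [Real.dist_eq, abs_le]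
  constructor <;> rintro ⟨h1, h2⟩ <;> constructor <;> linarith

end Cube

/-- The divergence theorem on `Q × (0, t]` for a test field in the half-space: the bottom face does
not contribute, the top face contributes at most `|Q|`, and the lateral faces at most a multiple
of `t`. -/
lemma setIntegral_slab_divergence_le (x : Fin n → ℝ) {r t : ℝ} (hr : 0 < r) (ht : 0 ≤ t)
    {φ : EuclideanSpace ℝ (Fin (n + 1)) → EuclideanSpace ℝ (Fin (n + 1))}
    (hφ : IsTestField (halfSpace n) φ) :
    ∫ z in slab (cube x r) 0 t, divergence φ z ≤
      volume.real (cube x r) + n * (2 * ((2 * r) ^ n / (2 * r))) * t := by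
  set a : Fin (n + 1) → ℝ := Fin.snoc (α := fun _ => ℝ) (fun i => x i - r) 0 with ha
  set b : Fin (n + 1) → ℝ := Fin.snoc (α := fun _ => ℝ) (fun i => x i + r) t with hb
  have hab : a ≤ b := by
    intro i
    refine Fin.lastCases ?_ (fun j => ?_) i
    · simpa [ha, hb] using ht
    · simp only [ha, hb, Fin.snoc_castSucc]
      linarith
  have hmem : ∀ z : EuclideanSpace ℝ (Fin (n + 1)), WithLp.ofLp z ∈ Set.Icc a b ↔
      (split n z).1 ∈ cube x r ∧ 0 ≤ (split n z).2 ∧ (split n z).2 ≤ t := by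
    intro z
    rw [mem_cube x hr.le, Set.mem_Icc, Pi.le_def, Pi.le_def, ← forall_and, Fin.forall_fin_succ']
    simp [ha, hb, split_fst_apply, split_snd]
  have hmeas : MeasurableSet (WithLp.ofLp ⁻¹' Set.Icc a b : Set (EuclideanSpace ℝ (Fin (n + 1)))) :=
    (isClosed_Icc.preimage (PiLp.continuous_ofLp 2 _)).measurableSet
  have h1 : ∫ z in slab (cube x r) 0 t, divergence φ z =
      ∫ z in (WithLp.ofLp ⁻¹' Set.Icc a b : Set (EuclideanSpace ℝ (Fin (n + 1)))),
        divergence φ z := by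
    refine (setIntegral_eq_of_subset_of_forall_sdiff_eq_zero hmeas
      (fun z hz => (hmem z).2 ⟨hz.1, hz.2.1.le, hz.2.2⟩) fun z hz => ?_).symm
    -- The closed box exceeds the slab by its bottom face only, where the field vanishes.
    refine divergence_eq_zero_of_notMem fun hz' => hz.2 ?_
    obtain ⟨h2, -, h3⟩ := (hmem z).1 hz.1
    exact ⟨h2, hφ.tsupport_subset hz', h3⟩
  have h2 := (PiLp.volume_preserving_ofLp (Fin (n + 1))).setIntegral_preimage_emb
    (MeasurableEquiv.toLp 2 (Fin (n + 1) → ℝ)).symm.measurableEmbedding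
    (fun w => divergence φ (WithLp.toLp 2 w)) (Set.Icc a b)
  have hD : ∀ w : Fin (n + 1) → ℝ, ∀ i, HasFDerivAt (fun w => φ (WithLp.toLp 2 w) i)
      ((EuclideanSpace.proj (𝕜 := ℝ) i).comp ((fderiv ℝ φ (WithLp.toLp 2 w)).comp
        (EuclideanSpace.equiv (Fin (n + 1)) ℝ).symm.toContinuousLinearMap)) w := by
    intro w i
    have e1 : HasFDerivAt φ (fderiv ℝ φ (WithLp.toLp 2 w)) (WithLp.toLp 2 w) :=
      (hφ.contDiff.differentiable one_ne_zero _).hasFDerivAt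
    have e2 : HasFDerivAt (fun w : Fin (n + 1) → ℝ => (WithLp.toLp 2 w : EuclideanSpace ℝ _))
        (EuclideanSpace.equiv (Fin (n + 1)) ℝ).symm.toContinuousLinearMap w :=
      (EuclideanSpace.equiv (Fin (n + 1)) ℝ).symm.toContinuousLinearMap.hasFDerivAt
    exact ((EuclideanSpace.proj (𝕜 := ℝ) i).hasFDerivAt.comp w (e1.comp w e2))
  have hcont : Continuous fun w : Fin (n + 1) → ℝ => divergence φ (WithLp.toLp 2 w) :=
    (continuous_divergence hφ.contDiff).comp (PiLp.continuous_toLp 2 _)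
  have hdiv : ∀ w : Fin (n + 1) → ℝ, divergence φ (WithLp.toLp 2 w) =
      ∑ i, ((EuclideanSpace.proj (𝕜 := ℝ) i).comp ((fderiv ℝ φ (WithLp.toLp 2 w)).comp
        (EuclideanSpace.equiv (Fin (n + 1)) ℝ).symm.toContinuousLinearMap)) (Pi.single i 1) :=
    fun w => rfl
  have h3 := integral_divergence_of_hasFDerivAt_off_countable' a b hab
    (fun i w => φ (WithLp.toLp 2 w) i)
    (fun i w => (EuclideanSpace.proj (𝕜 := ℝ) i).comp ((fderiv ℝ φ (WithLp.toLp 2 w)).comp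
        (EuclideanSpace.equiv (Fin (n + 1)) ℝ).symm.toContinuousLinearMap)) ∅ Set.countable_empty
    (fun i => (((EuclideanSpace.proj (𝕜 := ℝ) i).continuous.comp hφ.contDiff.continuous).comp
      (PiLp.continuous_toLp 2 _)).continuousOn)
    (fun w _ i => hD w i)
    (by
      simp only [← hdiv]
      exact hcont.continuousOn.integrableOn_compact isCompact_Icc)
  simp only [← hdiv] at h3
  have hnorm : ∀ (i : Fin (n + 1)) (w : Fin (n + 1) → ℝ), ‖φ (WithLp.toLp 2 w) i‖ ≤ 1 := fun i w =>
    (PiLp.norm_apply_le _ i).trans (hφ.norm_le_one _)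
  have hface : ∀ (i : Fin (n + 1)) (c : ℝ),
      ‖∫ y in Set.Icc (a ∘ i.succAbove) (b ∘ i.succAbove),
        φ (WithLp.toLp 2 (i.insertNth (α := fun _ => ℝ) c y)) i‖ ≤
      ∏ j, (b (i.succAbove j) - a (i.succAbove j)) := by
    intro i c
    have h4 := norm_setIntegral_le_of_norm_le_const
      (isCompact_Icc (a := a ∘ i.succAbove) (b := b ∘ i.succAbove)).measure_lt_top
      (f := fun y => φ (WithLp.toLp 2 (i.insertNth (α := fun _ => ℝ) c y)) i)
      (μ := volume) (C := 1) fun y _ => hnorm i _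
    have h5 := Real.volume_Icc_pi_toReal (a := a ∘ i.succAbove) (b := b ∘ i.succAbove)
      fun j => hab _
    rw [one_mul, measureReal_def, h5] at h4
    exact h4
  have hprod : ∀ i : Fin n, ∏ j, (b (i.castSucc.succAbove j) - a (i.castSucc.succAbove j)) =
      (2 * r) ^ n / (2 * r) * t := by
    intro i
    have e1 := Fin.prod_univ_succAbove (fun k => b k - a k) i.castSucc
    have e2 : ∏ k, (b k - a k) = (2 * r) ^ n * t := by
      rw [Fin.prod_univ_castSucc]
      have : ∀ j : Fin n, b j.castSucc - a j.castSucc = 2 * r := fun j => by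
        simp only [ha, hb, Fin.snoc_castSucc]
        ring
      simp only [this, Finset.prod_const, Finset.card_univ, Fintype.card_fin]
      simp [ha, hb]
    have e3 : b i.castSucc - a i.castSucc = 2 * r := by
      simp only [ha, hb, Fin.snoc_castSucc]
      ring
    rw [e2, e3] at e1
    field_simp
    linarith
  have hlast : ∏ j, (b ((Fin.last n).succAbove j) - a ((Fin.last n).succAbove j)) =
      volume.real (cube x r) := by
    have : ∀ j : Fin n, b j.castSucc - a j.castSucc = 2 * r := fun j => by
      simp only [ha, hb, Fin.snoc_castSucc]
      ring
    simp only [Fin.succAbove_last, this, volume_real_cube x hr.le]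
    simp
  have hbot : ∫ y in Set.Icc (a ∘ (Fin.last n).succAbove) (b ∘ (Fin.last n).succAbove),
      φ (WithLp.toLp 2 ((Fin.last n).insertNth (α := fun _ => ℝ) (a (Fin.last n)) y))
        (Fin.last n) = 0 := by
    refine integral_eq_zero_of_ae (Eventually.of_forall fun y => ?_)
    have h5 : (WithLp.toLp 2 ((Fin.last n).insertNth (α := fun _ => ℝ) (a (Fin.last n)) y) :
        EuclideanSpace ℝ (Fin (n + 1))) ∉ tsupport φ := fun h => by
      have h6 := hφ.tsupport_subset h
      simp [halfSpace, ha] at h6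
    simp only [image_eq_zero_of_notMem_tsupport h5]
    rfl
  rw [h1, h2, h3, Fin.sum_univ_castSucc, hbot, sub_zero, add_comm]
  refine add_le_add ?_ ?_
  · rw [← hlast]
    exact (le_abs_self _).trans (hface _ _)
  · calc _ ≤ ∑ _i : Fin n, 2 * ((2 * r) ^ n / (2 * r) * t) := by
          refine Finset.sum_le_sum fun i _ => ?_
          have f1 := (le_abs_self _).trans (hface i.castSucc (b i.castSucc))
          have f2 := (neg_le_abs _).trans (hface i.castSucc (a i.castSucc))
          rw [hprod] at f1 f2
          linarith
      _ = _ := by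
          rw [Finset.sum_const, Finset.card_univ, Fintype.card_fin, nsmul_eq_mul]
          ring

lemma integral_indicator_mul_divergence {S : Set (EuclideanSpace ℝ (Fin (n + 1)))}
    (hS : MeasurableSet S) (φ : EuclideanSpace ℝ (Fin (n + 1)) → EuclideanSpace ℝ (Fin (n + 1))) :
    ∫ z, S.indicator (fun _ => (1 : ℝ)) z * divergence φ z = ∫ z in S, divergence φ z := by
  rw [← integral_indicator hS]
  congr 1
  funext z
  by_cases hz : z ∈ S <;> simp [hz]

lemma perimeter_slab_zero_le (x : Fin n → ℝ) {r t : ℝ} (hr : 0 < r) (ht : 0 ≤ t) :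
    perimeter (slab (cube x r) 0 t) (halfSpace n) ≤ ENNReal.ofReal
      (volume.real (cube x r) + n * (2 * ((2 * r) ^ n / (2 * r))) * t) :=
  totalVariation_le fun φ hφ => by
    rw [integral_indicator_mul_divergence (measurableSet_slab (isClosed_cube x).measurableSet _ _)]
    exact ENNReal.ofReal_le_ofReal (setIntegral_slab_divergence_le x hr ht hφ)

/-! ### The perimeter of a slab moved away from the boundary -/

lemma divergence_cutoff_smul {φ : EuclideanSpace ℝ (Fin (n + 1)) → EuclideanSpace ℝ (Fin (n + 1))}
    (hφ : ContDiff ℝ 1 φ) (δ : ℝ) (x : EuclideanSpace ℝ (Fin (n + 1))) :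
    divergence (fun x => cutoff δ (split n x).2 • φ x) x =
      cutoff δ (split n x).2 * divergence φ x +
        deriv (cutoff δ) (split n x).2 * φ x (Fin.last n) := by
  set L : EuclideanSpace ℝ (Fin (n + 1)) →L[ℝ] ℝ :=
    (ContinuousLinearMap.snd ℝ (EuclideanSpace ℝ (Fin n)) ℝ).comp
      (split n).toContinuousLinearMap with hL
  have hLi : ∀ i, L (EuclideanSpace.single i 1) = if i = Fin.last n then 1 else 0 := by
    intro i
    change (split n (EuclideanSpace.single i 1)).2 = _
    rw [split_snd]
    simp [eq_comm]
  have h1 : HasFDerivAt (fun x => cutoff δ (split n x).2)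
      (deriv (cutoff δ) (split n x).2 • L) x :=
    (hasDerivAt_cutoff δ _).comp_hasFDerivAt x L.hasFDerivAt
  have h2 := (h1.smul (hφ.differentiable one_ne_zero x).hasFDerivAt).fderiv
  have h3 : divergence (fun x => cutoff δ (split n x).2 • φ x) x =
      ∑ i, (cutoff δ (split n x).2 * fderiv ℝ φ x (EuclideanSpace.single i 1) i +
        deriv (cutoff δ) (split n x).2 * L (EuclideanSpace.single i 1) * φ x i) := by
    rw [divergence]
    refine Finset.sum_congr rfl fun i _ => ?_
    have h4 : fderiv ℝ (fun x => cutoff δ (split n x).2 • φ x) x = _ := h2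
    rw [h4]
    simp
  rw [h3, Finset.sum_add_distrib, ← Finset.mul_sum]
  simp [hLi, divergence]

lemma setIntegral_slab_deriv_cutoff (Q : Set (EuclideanSpace ℝ (Fin n))) {δ : ℝ} (hδ : 0 < δ)
    (hδ1 : δ ≤ 1) :
    ∫ z in slab Q 0 1, deriv (cutoff δ) (split n z).2 = volume.real Q := by
  have h1 := measurePreserving_split.setIntegral_preimage_emb
    (split n).toHomeomorph.measurableEmbedding (fun p => 1 * deriv (cutoff δ) p.2)
    (Q ×ˢ Set.Ioc 0 1)
  rw [Measure.volume_eq_prod, setIntegral_prod_mul (fun _ => (1 : ℝ))] at h1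
  simp only [one_mul] at h1
  rw [slab, h1, ← intervalIntegral.integral_of_le zero_le_one,
    intervalIntegral.integral_eq_sub_of_hasDerivAt (fun t _ => hasDerivAt_cutoff δ t)
      ((continuous_deriv_cutoff δ).intervalIntegrable _ _),
    cutoff_of_ge hδ (by linarith), cutoff_of_le hδ (by positivity)]
  simp

lemma tendsto_cutoff {t : ℝ} (ht : 0 < t) : Tendsto (fun δ => cutoff δ t) (𝓝[>] 0) (𝓝 1) := by
  refine tendsto_const_nhds.congr' ?_
  filter_upwards [Ioo_mem_nhdsGT ht] with δ hδ
  exact (cutoff_of_ge hδ.1 (by linarith [hδ.2])).symm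

/-- A test field which need not vanish on `∂Ω` can exceed the perimeter in `Ω` by at most the area
of the part of `∂Ω` below the slab: cut the field off near `∂Ω`. -/
lemma setIntegral_slab_divergence_le_add {Q : Set (EuclideanSpace ℝ (Fin n))}
    (hQ : MeasurableSet Q) (hQ' : volume Q ≠ ∞)
    (hP : perimeter (slab Q 0 1) (halfSpace n) < ∞)
    {φ : EuclideanSpace ℝ (Fin (n + 1)) → EuclideanSpace ℝ (Fin (n + 1))}
    (hφ : ContDiff ℝ 1 φ) (hc : HasCompactSupport φ) (hb : ∀ x, ‖φ x‖ ≤ 1) :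
    ∫ z in slab Q 0 1, divergence φ z ≤
      (perimeter (slab Q 0 1) (halfSpace n)).toReal + volume.real Q := by
  set S := slab Q 0 1 with hS
  have hSm : MeasurableSet S := measurableSet_slab hQ 0 1
  have hSfin : volume S ≠ ∞ := by
    rw [hS, volume_slab]
    exact ENNReal.mul_ne_top hQ' ENNReal.ofReal_ne_top
  obtain ⟨D, hD⟩ := exists_bound_divergence hφ hc
  have hT : Continuous fun z : EuclideanSpace ℝ (Fin (n + 1)) => (split n z).2 :=
    continuous_snd.comp (split n).continuous
  have hΘ : ∀ δ : ℝ, AEStronglyMeasurable (fun z => cutoff δ (split n z).2 * divergence φ z)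
      (volume.restrict S) := fun δ =>
    (((contDiff_cutoff δ).continuous.comp hT).mul (continuous_divergence hφ)).aestronglyMeasurable
  have hΘb : ∀ δ z, ‖cutoff δ (split n z).2 * divergence φ z‖ ≤ D := fun δ z => by
    rw [norm_mul, Real.norm_of_nonneg cutoff_nonneg]
    exact (mul_le_of_le_one_left (norm_nonneg _) cutoff_le_one).trans (hD z)
  have hDi : IntegrableOn (fun _ : EuclideanSpace ℝ (Fin (n + 1)) => D) S :=
    integrableOn_const hSfin
  have hlim : Tendsto (fun δ => ∫ z in S, cutoff δ (split n z).2 * divergence φ z) (𝓝[>] 0)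
      (𝓝 (∫ z in S, divergence φ z)) := by
    refine tendsto_integral_filter_of_dominated_convergence (fun _ => D)
      (Eventually.of_forall hΘ) (Eventually.of_forall fun δ => Eventually.of_forall (hΘb δ)) hDi ?_
    refine (ae_restrict_iff' hSm).2 (Eventually.of_forall fun z hz => ?_)
    simpa using (tendsto_cutoff hz.2.1).mul_const (divergence φ z)
  refine le_of_tendsto hlim ?_
  filter_upwards [Ioo_mem_nhdsGT one_pos] with δ hδ
  have hsub : tsupport (fun x => cutoff δ (split n x).2 • φ x) ⊆
      tsupport φ ∩ {x | δ / 3 ≤ (split n x).2} := by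
    refine closure_minimal (fun x hx => ⟨?_, by_contra fun hx' => hx ?_⟩)
      ((isClosed_tsupport φ).inter (isClosed_le continuous_const hT))
    · exact subset_tsupport φ fun h0 => hx (by simp [h0])
    · simp [cutoff_of_le hδ.1 (not_le.1 hx').le]
  have htest : IsTestField (halfSpace n) fun x => cutoff δ (split n x).2 • φ x :=
    { contDiff := ((contDiff_cutoff δ).comp (split n).contDiff.snd).smul hφ
      hasCompactSupport := hc.of_isClosed_subset (isClosed_tsupport _)
        (hsub.trans Set.inter_subset_left)
      tsupport_subset := fun x hx => (div_pos hδ.1 three_pos).trans_le (hsub hx).2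
      norm_le_one := fun x => by
        rw [norm_smul, Real.norm_of_nonneg cutoff_nonneg]
        exact mul_le_one₀ cutoff_le_one (norm_nonneg _) (hb x) }
  have h1 := htest.integral_le hP
  rw [integral_indicator_mul_divergence hSm] at h1
  simp only [divergence_cutoff_smul hφ] at h1
  have hi1 : IntegrableOn (fun z => cutoff δ (split n z).2 * divergence φ z) S :=
    hDi.mono' (hΘ δ) (Eventually.of_forall (hΘb δ))
  obtain ⟨C, hC⟩ := exists_bound_deriv_cutoff hδ.1
  have hcd : Continuous fun z : EuclideanSpace ℝ (Fin (n + 1)) => deriv (cutoff δ) (split n z).2 :=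
    (continuous_deriv_cutoff δ).comp hT
  have hφl : ∀ z, ‖φ z (Fin.last n)‖ ≤ 1 := fun z => (PiLp.norm_apply_le _ _).trans (hb z)
  have hi2 : IntegrableOn (fun z : EuclideanSpace ℝ (Fin (n + 1)) =>
      deriv (cutoff δ) (split n z).2) S :=
    (integrableOn_const (C := C) hSfin).mono' hcd.aestronglyMeasurable
      (Eventually.of_forall fun z => hC _)
  have hi3 : IntegrableOn (fun z => deriv (cutoff δ) (split n z).2 * φ z (Fin.last n)) S :=
    hi2.mul_bdd (c := 1) ((EuclideanSpace.proj (𝕜 := ℝ)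
      (Fin.last n)).continuous.comp hφ.continuous).aestronglyMeasurable (Eventually.of_forall hφl)
  rw [integral_add hi1 hi3] at h1
  -- The term with the derivative of the cut-off is controlled since `cutoff δ` is monotone and
  -- increases by `1` in total.
  have h2 : -volume.real Q ≤ ∫ z in S, deriv (cutoff δ) (split n z).2 * φ z (Fin.last n) := by
    rw [← setIntegral_slab_deriv_cutoff Q hδ.1 hδ.2.le, ← integral_neg]
    refine integral_mono hi2.neg hi3 fun z => ?_
    have h3 := (abs_le.1 (hφl z)).1
    have h4 := deriv_cutoff_nonneg (t := (split n z).2) hδ.1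
    beta_reduce
    nlinarith
  have h5 : totalVariation (halfSpace n) (S.indicator fun _ => (1 : ℝ)) =
      perimeter S (halfSpace n) := rfl
  rw [h5] at h1
  linarith

/-- Moving a slab away from `∂Ω` increases its perimeter by at most the area of its base. -/
lemma perimeter_slab_translate_le {Q : Set (EuclideanSpace ℝ (Fin n))}
    (hQ : MeasurableSet Q) (hQ' : volume Q ≠ ∞)
    (hP : perimeter (slab Q 0 1) (halfSpace n) < ∞) (s : ℝ) :
    perimeter (slab Q s (1 + s)) (halfSpace n) ≤ ENNReal.ofReal
      ((perimeter (slab Q 0 1) (halfSpace n)).toReal + volume.real Q) := by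
  refine totalVariation_le fun φ hφ => ENNReal.ofReal_le_ofReal ?_
  set v : EuclideanSpace ℝ (Fin (n + 1)) := s • up n with hv
  have hdiv : ∀ z, divergence (fun z => φ (z + v)) z = divergence φ (z + v) := fun z => by
    simp only [divergence]
    rw [fderiv_comp_add_right]
  have hmem : ∀ z, z + v ∈ slab Q s (1 + s) ↔ z ∈ slab Q 0 1 := fun z => by
    rw [mem_slab, mem_slab, split_add_smul_up]
    simp
  rw [← integral_add_right_eq_self _ v]
  have h1 : ∀ z, (slab Q s (1 + s)).indicator (fun _ => (1 : ℝ)) (z + v) * divergence φ (z + v) =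
      (slab Q 0 1).indicator (fun _ => (1 : ℝ)) z * divergence (fun z => φ (z + v)) z := fun z => by
    rw [hdiv]
    congr 1
    by_cases hz : z ∈ slab Q 0 1
    · rw [Set.indicator_of_mem hz, Set.indicator_of_mem ((hmem z).2 hz)]
    · rw [Set.indicator_of_notMem hz, Set.indicator_of_notMem fun h => hz ((hmem z).1 h)]
  simp only [h1]
  rw [integral_indicator_mul_divergence (measurableSet_slab hQ 0 1)]
  exact setIntegral_slab_divergence_le_add hQ hQ' hP
    (hφ.contDiff.comp (contDiff_id.add contDiff_const))
    (hφ.hasCompactSupport.comp_homeomorph (Homeomorph.addRight v)) fun z => hφ.norm_le_one _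

/-! ### Traces and convergence of slabs -/

lemma hasTraceAt_of_eqOn {u : EuclideanSpace ℝ (Fin (n + 1)) → ℝ} {x : EuclideanSpace ℝ (Fin n)}
    {a r : ℝ} (hr : 0 < r) (h : ∀ z ∈ cylinder (Metric.ball x r) r, u z = a) :
    HasTraceAt u x a := by
  refine tendsto_const_nhds.congr' ?_
  filter_upwards [Ioo_mem_nhdsGT hr] with s hs
  rw [setAverage_eq]
  have h1 : ∫ y in Metric.ball (boundaryPoint x) s ∩ halfSpace n, |u y - a| = 0 := by
    refine setIntegral_eq_zero_of_forall_eq_zero fun z hz => ?_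
    have h2 := cylinder_mono (Metric.ball_subset_ball hs.2.le) hs.2.le
      (ball_inter_halfSpace_subset_cylinder x s hz)
    rw [h z h2, sub_self, abs_zero]
  rw [h1, smul_zero]

lemma integrable_indicator_slab {Q : Set (EuclideanSpace ℝ (Fin n))} (hQ : MeasurableSet Q)
    (hQ' : volume Q ≠ ∞) (s t : ℝ) :
    Integrable ((slab Q s t).indicator fun _ => (1 : ℝ)) := by
  refine (integrable_indicator_iff (measurableSet_slab hQ s t)).2 (integrableOn_const ?_)
  rw [volume_slab]
  exact ENNReal.mul_ne_top hQ' ENNReal.ofReal_ne_top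

/-- The trace of a slab touching `∂Ω` is the characteristic function of its base. -/
lemma trace_slab_zero (x : Fin n → ℝ) {r t : ℝ} (ht : 0 < t) :
    trace ((slab (cube x r) 0 t).indicator fun _ => (1 : ℝ)) =ᵐ[volume]
      (cube x r).indicator fun _ => 1 := by
  have hint := integrable_indicator_slab (isClosed_cube x (r := r)).measurableSet
    (volume_cube_ne_top x) 0 t
  have hfr : ∀ᵐ y, y ∉ frontier (cube x r) := measure_eq_zero_iff_ae_notMem.1
    (volume_frontier_cube x)
  filter_upwards [hfr] with y hy
  by_cases hyQ : y ∈ cube x r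
  · have hyi : y ∈ interior (cube x r) := by
      by_contra hcon
      exact hy ⟨subset_closure hyQ, hcon⟩
    obtain ⟨ρ, hρ, hsub⟩ := Metric.mem_nhds_iff.1 (mem_interior_iff_mem_nhds.1 hyi)
    rw [Set.indicator_of_mem hyQ]
    refine HasTraceAt.trace_eq hint (hasTraceAt_of_eqOn (lt_min hρ ht) fun z hz => ?_)
    obtain ⟨h1, h2, h3⟩ := mem_cylinder.1 hz
    exact Set.indicator_of_mem (mem_slab.2
      ⟨hsub (Metric.ball_subset_ball (min_le_left _ _) h1), h2, h3.le.trans (min_le_right _ _)⟩) _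
  · obtain ⟨ρ, hρ, hsub⟩ := Metric.mem_nhds_iff.1 ((isClosed_cube x).isOpen_compl.mem_nhds hyQ)
    rw [Set.indicator_of_notMem hyQ]
    refine HasTraceAt.trace_eq hint (hasTraceAt_of_eqOn hρ fun z hz => ?_)
    exact Set.indicator_of_notMem (fun h => hsub (mem_cylinder.1 hz).1 h.1) _

/-- The trace of a slab at positive height vanishes. -/
lemma trace_slab_of_pos {Q : Set (EuclideanSpace ℝ (Fin n))} (hQ : MeasurableSet Q)
    (hQ' : volume Q ≠ ∞) {s t : ℝ} (hs : 0 < s) (y : EuclideanSpace ℝ (Fin n)) :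
    trace ((slab Q s t).indicator fun _ => (1 : ℝ)) y = 0 :=
  HasTraceAt.trace_eq (integrable_indicator_slab hQ hQ' s t) (hasTraceAt_of_eqOn hs fun _ hz =>
    Set.indicator_of_notMem (fun h => lt_asymm h.2.1 (mem_cylinder.1 hz).2.2) _)

/-- A slab of finite perimeter, as an element of `BV(Ω, {0,1})`. -/
def slabSet {Q : Set (EuclideanSpace ℝ (Fin n))} (hQ : MeasurableSet Q) (hQ' : volume Q ≠ ∞)
    {s t : ℝ} (hs : 0 ≤ s) (hP : perimeter (slab Q s t) (halfSpace n) < ∞) : BVSet n :=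
  ⟨slab Q s t, slab_subset_halfSpace hs,
    ⟨(integrable_indicator_slab hQ hQ' s t).integrableOn, hP⟩⟩

/-- Pointwise convergence of measurable sets which stay in a set of finite measure implies
convergence in `BV(Ω, {0,1})`. -/
lemma tendsto_bvSet_of_eventually {E : ℕ → BVSet n} {F : BVSet n}
    {Z : Set (EuclideanSpace ℝ (Fin (n + 1)))} (hZm : MeasurableSet Z) (hZ : volume Z ≠ ∞)
    (hE : ∀ k, (E k).carrier ⊆ Z) (hF : F.carrier ⊆ Z)
    (h : ∀ z, ∀ᶠ k in atTop, z ∈ (E k).carrier ↔ z ∈ F.carrier) :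
    Tendsto E atTop (𝓝 F) := by
  have key : Tendsto (fun k => (E k).char.toL1) atTop (𝓝 F.char.toL1) := by
    rw [tendsto_iff_dist_tendsto_zero]
    have h1 : ∀ k, dist (E k).char.toL1 F.char.toL1 = ∫ z in halfSpace n,
        |(E k).char.toFun z - F.char.toFun z| := by
      intro k
      rw [L1.dist_eq_integral_dist]
      refine integral_congr_ae ?_
      filter_upwards [Integrable.coeFn_toL1 (E k).char.isBV.integrableOn,
        Integrable.coeFn_toL1 F.char.isBV.integrableOn] with z h2 h3
      rw [BV.toL1, BV.toL1, h2, h3, Real.dist_eq]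
    simp only [h1]
    have h0 : ∫ _ in halfSpace n, (0 : ℝ) = 0 := integral_zero _ _
    rw [← h0]
    have hZi : Integrable (Z.indicator fun _ => (1 : ℝ)) :=
      (integrable_indicator_iff hZm).2 (integrableOn_const hZ)
    refine tendsto_integral_of_dominated_convergence (Z.indicator fun _ => 1)
      (fun k => ((E k).char.isBV.integrableOn.sub F.char.isBV.integrableOn).abs.1) hZi.restrict
      (fun k => Eventually.of_forall fun z => ?_) (Eventually.of_forall fun z => ?_)
    · simp only [BVSet.char, Real.norm_eq_abs, abs_abs]
      by_cases hz : z ∈ Z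
      · by_cases hz1 : z ∈ (E k).carrier <;> by_cases hz2 : z ∈ F.carrier <;> simp [hz, hz1, hz2]
      · have hz1 : z ∉ (E k).carrier := fun h => hz (hE k h)
        have hz2 : z ∉ F.carrier := fun h => hz (hF h)
        simp [hz, hz1, hz2]
    · refine tendsto_const_nhds.congr' ?_
      filter_upwards [h z] with k hk
      have h2 : (E k).char.toFun z = F.char.toFun z := by
        simp only [BVSet.char]
        by_cases hz : z ∈ F.carrier
        · rw [Set.indicator_of_mem hz, Set.indicator_of_mem (hk.2 hz)]
        · rw [Set.indicator_of_notMem hz, Set.indicator_of_notMem fun h => hz (hk.1 h)]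
      rw [h2, sub_self, abs_zero]
  rw [nhds_induced, tendsto_comap_iff, nhds_induced, tendsto_comap_iff]
  exact key

/-! ### Failure of lower semicontinuity when `|β| > 1` on a set of positive measure -/

/-- If `|β| ≤ 1` fails, then by Lebesgue differentiation there is a cube on which the mean of `β`
exceeds `1` in absolute value. -/
lemma exists_cube_lt_abs_setIntegral {β : EuclideanSpace ℝ (Fin n) → ℝ}
    (hβ : MemLp β ∞ volume) (h : ¬ ∀ᵐ y, ‖β y‖ ≤ 1) :
    ∃ (x : Fin n → ℝ) (r : ℝ), 0 < r ∧
      volume.real (cube x r) < |∫ y in cube x r, β y| := by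
  have hmp := PiLp.volume_preserving_toLp (Fin n)
  set β' : (Fin n → ℝ) → ℝ := fun w => β (WithLp.toLp 2 w) with hβ'
  have hloc : LocallyIntegrable β' :=
    (hβ.comp_measurePreserving hmp).locallyIntegrable le_top
  have hleb := (Besicovitch.vitaliFamily (volume : Measure (Fin n → ℝ))).ae_tendsto_average hloc
  have hex : ∃ x, 1 < |β' x| ∧ Tendsto (fun a => ⨍ y in a, β' y)
      ((Besicovitch.vitaliFamily (volume : Measure (Fin n → ℝ))).filterAt x) (𝓝 (β' x)) := by
    by_contra! hcon
    refine h ?_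
    have h1 : ∀ᵐ w, ‖β' w‖ ≤ 1 := by
      filter_upwards [hleb] with w hw
      exact le_of_not_gt fun h2 => hcon w h2 hw
    have h2 := (PiLp.volume_preserving_ofLp (Fin n)).quasiMeasurePreserving.ae h1
    filter_upwards [h2] with y hy using hy
  obtain ⟨x, hx1, hx⟩ := hex
  have h3 := (hx.comp (Besicovitch.tendsto_filterAt volume x)).abs
  obtain ⟨r, h4, hr⟩ := ((h3.eventually (lt_mem_nhds hx1)).and self_mem_nhdsWithin).exists
  refine ⟨x, r, hr, ?_⟩
  have hr' : 0 < r := hr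
  have hpos : 0 < volume.real (Metric.closedBall x r) :=
    ENNReal.toReal_pos (Metric.measure_closedBall_pos volume x hr').ne'
      measure_closedBall_lt_top.ne
  have h5 := (PiLp.volume_preserving_ofLp (Fin n)).setIntegral_preimage_emb
    (MeasurableEquiv.toLp 2 (Fin n → ℝ)).symm.measurableEmbedding β' (Metric.closedBall x r)
  have h6 : ∫ y in cube x r, β y = ∫ w in Metric.closedBall x r, β' w := h5
  rw [h6, measureReal_def, volume_cube, ← measureReal_def]
  simp only [Function.comp_apply, setAverage_eq, smul_eq_mul, abs_mul, abs_inv,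
    abs_of_pos hpos] at h4
  rwa [lt_inv_mul_iff₀ hpos, mul_one] at h4

lemma capillary_eq {β : EuclideanSpace ℝ (Fin n) → ℝ} (E : BVSet n)
    {f : EuclideanSpace ℝ (Fin n) → ℝ}
    (h : trace (E.carrier.indicator fun _ => (1 : ℝ)) =ᵐ[volume] f) :
    capillary β E = (perimeter E.carrier (halfSpace n)).toReal - ∫ y, β y * f y := by
  rw [capillary]
  congr 1
  refine integral_congr_ae ?_
  filter_upwards [h] with y hy
  rw [← hy]
  rfl

lemma integral_mul_indicator_one {β : EuclideanSpace ℝ (Fin n) → ℝ}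
    {Q : Set (EuclideanSpace ℝ (Fin n))} (hQ : MeasurableSet Q) :
    ∫ y, β y * Q.indicator (fun _ => 1) y = ∫ y in Q, β y := by
  rw [← integral_indicator hQ]
  congr 1
  funext y
  by_cases hy : y ∈ Q <;> simp [hy]

lemma le_of_lowerSemicontinuous_of_tendsto {α : Type*} [TopologicalSpace α] {f : α → ℝ}
    (hf : LowerSemicontinuous f) {E : ℕ → α} {F : α} (hE : Tendsto E atTop (𝓝 F)) {b : ℕ → ℝ}
    {B : ℝ} (hb : Tendsto b atTop (𝓝 B)) (h : ∀ k, f (E k) ≤ b k) : f F ≤ B := by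
  refine le_of_forall_lt fun c hc => ?_
  obtain ⟨c', hc1, hc2⟩ := exists_between hc
  refine hc1.trans_le (ge_of_tendsto hb ?_)
  filter_upwards [hE.eventually (hf F c' hc2)] with k hk using hk.le.trans (h k)

/-- Lower semicontinuity at `∅` along thin slabs `Q × (0, 1 / k]` bounds `∫_Q β` from above. -/
lemma setIntegral_cube_le {β : EuclideanSpace ℝ (Fin n) → ℝ}
    (hlsc : LowerSemicontinuous (capillary β)) (x : Fin n → ℝ) {r : ℝ} (hr : 0 < r) :
    ∫ y in cube x r, β y ≤ volume.real (cube x r) := by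
  have hQ : MeasurableSet (cube x r) := (isClosed_cube x).measurableSet
  have hQ' : volume (cube x r) ≠ ∞ := volume_cube_ne_top x
  have hP : ∀ {t : ℝ}, 0 ≤ t → perimeter (slab (cube x r) 0 t) (halfSpace n) < ∞ := fun ht =>
    (perimeter_slab_zero_le x hr ht).trans_lt ENNReal.ofReal_lt_top
  set A : ℝ := n * (2 * ((2 * r) ^ n / (2 * r))) with hA
  set s : ℕ → ℝ := fun k => 1 / ((k : ℝ) + 1) with hs
  have hs0 : ∀ k, 0 < s k := fun k => by positivity
  have hs1 : ∀ k, s k ≤ 1 := fun k => by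
    rw [hs, div_le_one (by positivity)]
    linarith [Nat.cast_nonneg (α := ℝ) k]
  have hslim : Tendsto s atTop (𝓝 0) := tendsto_one_div_add_atTop_nhds_zero_nat
  set E : ℕ → BVSet n := fun k => slabSet hQ hQ' le_rfl (hP (hs0 k).le) with hE
  set F : BVSet n := slabSet hQ hQ' le_rfl (hP (t := 0) le_rfl) with hF
  have hFe : F.carrier = ∅ := by
    refine Set.eq_empty_of_forall_notMem fun z hz => ?_
    exact hz.2.1.not_ge hz.2.2
  have hZ : volume (slab (cube x r) 0 1) ≠ ∞ := by
    rw [volume_slab]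
    exact ENNReal.mul_ne_top hQ' ENNReal.ofReal_ne_top
  have hconv : Tendsto E atTop (𝓝 F) := by
    refine tendsto_bvSet_of_eventually (measurableSet_slab hQ 0 1) hZ
      (fun k z hz => ⟨hz.1, hz.2.1, hz.2.2.trans (hs1 k)⟩) (by simp [hFe]) fun z => ?_
    simp only [hFe, Set.mem_empty_iff_false, iff_false]
    rcases le_or_gt (split n z).2 0 with hz | hz
    · exact Eventually.of_forall fun k h => hz.not_gt h.2.1
    · filter_upwards [hslim.eventually (gt_mem_nhds hz)] with k hk h
      exact hk.not_ge h.2.2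
  have hF0 : capillary β F = 0 := by
    have htr : trace (F.carrier.indicator fun _ => (1 : ℝ)) =ᵐ[volume] fun _ => 0 :=
      Eventually.of_forall fun y => by
        refine HasTraceAt.trace_eq (integrable_indicator_slab hQ hQ' 0 0)
          (hasTraceAt_of_eqOn one_pos fun z _ => ?_)
        exact Set.indicator_of_notMem (fun hz => hz.2.1.not_ge hz.2.2) _
    have hper : perimeter F.carrier (halfSpace n) = 0 := by
      rw [hFe, perimeter, ← nonpos_iff_eq_zero]
      exact totalVariation_le fun φ _ => by simp
    rw [capillary_eq F htr, hper]
    simp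
  have hEk : ∀ k, capillary β (E k) ≤
      volume.real (cube x r) + A * s k - ∫ y in cube x r, β y := by
    intro k
    rw [capillary_eq (E k) (trace_slab_zero x (hs0 k)), integral_mul_indicator_one hQ]
    refine sub_le_sub_right (ENNReal.toReal_le_of_le_ofReal ?_
      (perimeter_slab_zero_le x hr (hs0 k).le)) _
    have := measureReal_nonneg (μ := volume) (s := cube x r)
    have := hs0 k
    positivity
  have hblim : Tendsto (fun k => volume.real (cube x r) + A * s k - ∫ y in cube x r, β y) atTop
      (𝓝 (volume.real (cube x r) + A * 0 - ∫ y in cube x r, β y)) :=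
    ((hslim.const_mul A).const_add _).sub_const _
  have h := le_of_lowerSemicontinuous_of_tendsto hlsc hconv hblim hEk
  rw [hF0] at h
  linarith

/-- Lower semicontinuity at `Q × (0, 1]` along its translates away from `∂Ω` bounds `∫_Q β` from
below. -/
lemma neg_le_setIntegral_cube {β : EuclideanSpace ℝ (Fin n) → ℝ}
    (hlsc : LowerSemicontinuous (capillary β)) (x : Fin n → ℝ) {r : ℝ} (hr : 0 < r) :
    -volume.real (cube x r) ≤ ∫ y in cube x r, β y := by
  have hQ : MeasurableSet (cube x r) := (isClosed_cube x).measurableSet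
  have hQ' : volume (cube x r) ≠ ∞ := volume_cube_ne_top x
  have hP : perimeter (slab (cube x r) 0 1) (halfSpace n) < ∞ :=
    (perimeter_slab_zero_le x hr zero_le_one).trans_lt ENNReal.ofReal_lt_top
  have hPs := perimeter_slab_translate_le hQ hQ' hP
  set s : ℕ → ℝ := fun k => 1 / ((k : ℝ) + 1) with hs
  have hs0 : ∀ k, 0 < s k := fun k => by positivity
  have hs1 : ∀ k, s k ≤ 1 := fun k => by
    rw [hs, div_le_one (by positivity)]
    linarith [Nat.cast_nonneg (α := ℝ) k]
  have hslim : Tendsto s atTop (𝓝 0) := tendsto_one_div_add_atTop_nhds_zero_nat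
  set E : ℕ → BVSet n := fun k =>
    slabSet hQ hQ' (hs0 k).le ((hPs (s k)).trans_lt ENNReal.ofReal_lt_top) with hE
  set F : BVSet n := slabSet hQ hQ' le_rfl hP with hF
  have hZ : volume (slab (cube x r) 0 2) ≠ ∞ := by
    rw [volume_slab]
    exact ENNReal.mul_ne_top hQ' ENNReal.ofReal_ne_top
  have hconv : Tendsto E atTop (𝓝 F) := by
    refine tendsto_bvSet_of_eventually (measurableSet_slab hQ 0 2) hZ
      (fun k z hz => ⟨hz.1, (hs0 k).trans hz.2.1, hz.2.2.trans (by linarith [hs1 k])⟩)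
      (fun z hz => ⟨hz.1, hz.2.1, hz.2.2.trans one_le_two⟩) fun z => ?_
    have hmem : ∀ k, z ∈ (E k).carrier ↔
        (split n z).1 ∈ cube x r ∧ s k < (split n z).2 ∧ (split n z).2 ≤ 1 + s k := fun k => Iff.rfl
    have hmem' : z ∈ F.carrier ↔
        (split n z).1 ∈ cube x r ∧ 0 < (split n z).2 ∧ (split n z).2 ≤ 1 := Iff.rfl
    simp only [hmem, hmem']
    rcases le_or_gt (split n z).2 0 with hz | hz
    · exact Eventually.of_forall fun k => iff_of_false (fun h => by linarith [hs0 k, h.2.1])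
        fun h => by linarith [h.2.1]
    rcases le_or_gt (split n z).2 1 with hz1 | hz1
    · filter_upwards [hslim.eventually (gt_mem_nhds hz)] with k hk
      exact ⟨fun h => ⟨h.1, hz, hz1⟩, fun h => ⟨h.1, hk, by linarith [hs0 k]⟩⟩
    · filter_upwards [hslim.eventually (gt_mem_nhds (sub_pos.2 hz1))] with k hk
      exact iff_of_false (fun h => by linarith [h.2.2]) fun h => by linarith [h.2.2]
  have hEk : ∀ k, capillary β (E k) ≤
      (perimeter (slab (cube x r) 0 1) (halfSpace n)).toReal + volume.real (cube x r) := by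
    intro k
    rw [capillary_eq (E k) (Eventually.of_forall (trace_slab_of_pos hQ hQ' (hs0 k)))]
    simp only [mul_zero, integral_zero, sub_zero]
    exact ENNReal.toReal_le_of_le_ofReal
      (add_nonneg ENNReal.toReal_nonneg measureReal_nonneg) (hPs (s k))
  have h := le_of_lowerSemicontinuous_of_tendsto hlsc hconv tendsto_const_nhds hEk
  rw [capillary_eq F (trace_slab_zero x one_pos), integral_mul_indicator_one hQ] at h
  have h2 : perimeter F.carrier (halfSpace n) =
      perimeter (slab (cube x r) 0 1) (halfSpace n) := rfl
  rw [h2] at h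
  linarith

lemma ae_norm_le_one_of_lowerSemicontinuous_capillary {β : EuclideanSpace ℝ (Fin n) → ℝ}
    (hβ : MemLp β ∞ volume) (hlsc : LowerSemicontinuous (capillary β)) :
    ∀ᵐ y, ‖β y‖ ≤ 1 := by
  by_contra hcon
  obtain ⟨x, r, hr, h⟩ := exists_cube_lt_abs_setIntegral hβ hcon
  exact h.not_ge (abs_le.2 ⟨neg_le_setIntegral_cube hlsc x hr, setIntegral_cube_le hlsc x hr⟩)

lemma eLpNorm_top_le_one_iff {β : EuclideanSpace ℝ (Fin n) → ℝ} :
    eLpNorm β ∞ volume ≤ 1 ↔ ∀ᵐ y, ‖β y‖ ≤ 1 := by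
  rw [eLpNorm_exponent_top]
  constructor
  · intro h
    filter_upwards [enorm_ae_le_eLpNormEssSup β volume] with y hy
    have h1 := hy.trans h
    rwa [← ofReal_norm, ENNReal.ofReal_le_one] at h1
  · intro h
    simpa using eLpNormEssSup_le_of_ae_bound h

end Capillary

theorem mainTheorem10 (n : ℕ) (β : EuclideanSpace ℝ (Fin n) → ℝ) (hβ : MemLp β ∞ volume) :
    (LowerSemicontinuous (Capillary.capillary β) ↔ eLpNorm β ∞ volume ≤ 1) ∧
    (LowerSemicontinuous (Capillary.levelSetCapillary β) ↔ eLpNorm β ∞ volume ≤ 1) := by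
  rw [Capillary.eLpNorm_top_le_one_iff]
  have h1 : (∀ᵐ y, ‖β y‖ ≤ 1) → LowerSemicontinuous (Capillary.levelSetCapillary β) :=
    Capillary.lowerSemicontinuous_levelSetCapillary hβ.1
  have h2 : LowerSemicontinuous (Capillary.levelSetCapillary β) →
      LowerSemicontinuous (Capillary.capillary β) :=
    Capillary.lowerSemicontinuous_capillary_of_levelSetCapillary
  have h3 : LowerSemicontinuous (Capillary.capillary β) → ∀ᵐ y, ‖β y‖ ≤ 1 :=
    Capillary.ae_norm_le_one_of_lowerSemicontinuous_capillary hβ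
  exact ⟨⟨h3, h2 ∘ h1⟩, ⟨h3 ∘ h2, h1⟩⟩
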